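/- Let $\Omega=\{0,1\}^{\mathbb N}$, for a finite binary word $x$ let $x\Omega$ be the set of sequences beginning with $x$, and for $p\in[0,1]$ let $B_p$ be the Bernoulli measure on $\Omega$ (independent digits, each equal to $1$ with probability $p$). A function $t\colon\Omega\to[0,\infty]$ is lower semicomputable (relative to an oracle) if there is an algorithm (with this oracle) that, given a rational $r$, enumerates words $x$ such that $\{\omega: r<t(\omega)\}$ is the union of the sets $x\Omega$. A function $t\colon\Omega\times[0,1]\to[0,\infty]$ is lower semicomputable if there is an algorithm that, given a rational $r$, enumerates rectangles $x\Omega\times((u,v)\cap[0,1])$ with $u,v$ rational whose union is $\{(\omega,p): r<t(\omega,p)\}$. An oracle for $p\in[0,1]$ returns, given $i$, the $i$-th digit of a binary expansion $0.b_0b_1b_2\ldots$ of $p$ (any of the expansions may be used if there are two). A Bernoulli test is a lower semicomputable $t\colon\Omega\to[0,\infty]$ with $\int t\,dB_p\le1$ for all $p\in[0,1]$. A uniform Bernoulli test is a lower semicomputable $t\colon\Omega\times[0,1]\to[0,\infty]$ with $\int t(\omega,p)\,dB_p(\omega)\le 1$ for all $p\in[0,1]$. For a fixed $p$, a $p$-relativized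 $B_p$-test is a function $t\colon\Omega\to[0,\infty]$ that is lower semicomputable relative to the oracle for $p$ and satisfies $\int t\,dB_p\le 1$. A test $u$ of one of these kinds is universal if for each test $t$ of the same kind there is a finite constant $c$ with $t\le c\,u$ everywhere. A sequence is Bernoulli if a universal Bernoulli test is finite on it. A sequence is random with respect to $B_p$ with oracle $p$ if every $p$-relativized $B_p$-test is finite on it. It is Martin-Löf random with respect to $B_p$ with oracle $p$ if it lies outside $\bigcap_i U_i$ for every sequence of sets $U_i$ that are unions of sets $x\Omega$ enumerated, uniformly in $i$, with the oracle for $p$ and satisfy $B_p(U_i)\le 2^{-i}$. Then: (1) There exist a universal Bernoulli test, a universal uniform Bernoulli test and, for each $p\in[0,1]$ (and each binary expansion of $p$ as the oracle), a universal $p$-relativized $B_p$-test. (2) If $t$ is a universal uniform Bernoulli test and $t_{\mathcal B}$ a universal Bernoulli test, then $\inf_{p\in[0,1]}t(\omega,p)$ and $t_{\mathcal B}(\omega)$ coincide up to a multiplicative constant: each is at most a finite constant, not depending on $\omega$, times the other. (3) If $t$ is a universal uniform Bernoulli test, then for each fixed $p\in[0,1]$ the function $\omega\mapsto t(\omega,p)$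 coincides, up to a multiplicative constant not depending on $\omega$ (it may depend on $p$), with each universal $p$-relativized $B_p$-test. (4) For each universal Bernoulli test $t_{\mathcal B}$ and each $\omega\in\Omega$: $t_{\mathcal B}(\omega)<\infty$ (that is, $\omega$ is Bernoulli) if and only if for some $p\in[0,1]$ the sequence $\omega$ is Martin-Löf random with respect to $B_p$ with oracle $p$, and also if and only if for some $p\in[0,1]$ it is random with respect to $B_p$ with oracle $p$. This holds whichever binary expansion of each $p$ serves as the oracle. -/

import Mathlib

open MeasureTheory ProbabilityTheory
open scoped ENNReal NNReal unitInterval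

namespace BernoulliTests

/-- The Cantor space `Ω` of infinite binary sequences, `true` standing for the digit `1`. -/
abbrev Omega : Type := ℕ → Bool

/-- The interval `xΩ`: all infinite sequences that begin with the binary word `x`. -/
def wordCylinder (x : List Bool) : Set Omega :=
  {ω | ∀ i : Fin x.length, ω i = x.get i}

/-- Codes of rational numbers; every rational number has codes. -/
abbrev RatCode : Type := ℕ × ℕ × ℕ

/-- The rational number `(a - b) / (c + 1)` coded by `(a, b, c)`. -/
def ratOf (r : RatCode) : ℚ := ((r.1 : ℚ) - (r.2.1 : ℚ)) / ((r.2.2 : ℚ) + 1)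

/-- The basic rectangle `xΩ × ((u, v) ∩ [0,1])` in `Ω × [0,1]`, where `u, v` are rational
(it is empty when `v ≤ u`). -/
def rectangle (a : List Bool × RatCode × RatCode) : Set (Omega × I) :=
  {z | z.1 ∈ wordCylinder a.1 ∧ (ratOf a.2.1 : ℝ) < (z.2 : ℝ) ∧ (z.2 : ℝ) < (ratOf a.2.2 : ℝ)}

/-- Recursive enumerability with oracles from `O`: the predicate is the domain of a partial
function recursive in `O`. For `O = ∅` this is `REPred`. -/
def REPredIn {α : Type} [Primcodable α] (O : Set (ℕ →. ℕ)) (P : α → Prop) : Prop :=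
  RecursiveIn O fun a => Part.assert (P a) fun _ => Part.some ()

/-- A family `U` of sets is effectively open, uniformly in the index `i` and relative to `O`:
each `U i` is a union of basic sets `base a` that can be enumerated given `i`. -/
def UniformlyEffectivelyOpen {ι α X : Type} [Primcodable ι] [Primcodable α]
    (O : Set (ℕ →. ℕ)) (base : α → Set X) (U : ι → Set X) : Prop :=
  ∃ W : ι × α → Prop, REPredIn O W ∧ ∀ i, U i = {x | ∃ a, W (i, a) ∧ x ∈ base a}

/-- Lower semicomputability, relative to `O`, of a function with values in `[0, ∞]`: the sets
`{x | r < t x}` are effectively open uniformly in the rational number `r`. -/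
def LowerSemicomputable {α X : Type} [Primcodable α] (O : Set (ℕ →. ℕ)) (base : α → Set X)
    (t : X → ℝ≥0∞) : Prop :=
  UniformlyEffectivelyOpen O base
    fun r : RatCode => {x | ((ratOf r : ℝ) : EReal) < ((t x : ℝ≥0∞) : EReal)}

/-- The Bernoulli measure `B_p` on `Ω`: independent digits, each equal to `1` with
probability `p`. -/
noncomputable def bernoulliProd (p : I) : Measure Omega :=
  Measure.infinitePi fun _ : ℕ => bernoulliMeasure true false p

/-- Randomness tests of bounded expectation with respect to `P`, relative to `O`. -/
def IsTest (O : Set (ℕ →. ℕ)) (P : Measure Omega) (t : Omega → ℝ≥0∞) : Prop :=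
  LowerSemicomputable O wordCylinder t ∧ ∫⁻ ω, t ω ∂P ≤ 1

/-- Bernoulli tests of bounded expectation. -/
def IsBernoulliTest (t : Omega → ℝ≥0∞) : Prop :=
  LowerSemicomputable ∅ wordCylinder t ∧ ∀ p : I, ∫⁻ ω, t ω ∂(bernoulliProd p) ≤ 1

/-- Uniform Bernoulli tests, functions of a sequence and a parameter `p ∈ [0,1]`. -/
def IsUniformBernoulliTest (t : Omega × I → ℝ≥0∞) : Prop :=
  LowerSemicomputable ∅ rectangle t ∧ ∀ p : I, ∫⁻ ω, t (ω, p) ∂(bernoulliProd p) ≤ 1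

/-- `f ≤ c · g` everywhere, for some finite constant `c`. -/
def DominatedBy {X : Type} (f g : X → ℝ≥0∞) : Prop :=
  ∃ c : ℝ≥0, ∀ x, f x ≤ (c : ℝ≥0∞) * g x

/-- `f` and `g` coincide up to a multiplicative constant. -/
def EqUpToConst {X : Type} (f g : X → ℝ≥0∞) : Prop :=
  DominatedBy f g ∧ DominatedBy g f

/-- `u` is universal in the class `C` of functions: it belongs to `C` and is maximal there up to
a multiplicative constant. -/
def IsUniversal {X : Type} (C : (X → ℝ≥0∞) → Prop) (u : X → ℝ≥0∞) : Prop :=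
  C u ∧ ∀ t, C t → DominatedBy t u

/-- `ω` passes every test of bounded expectation with respect to `P` relative to `O`. -/
def IsRandom (O : Set (ℕ →. ℕ)) (P : Measure Omega) (ω : Omega) : Prop :=
  ∀ t, IsTest O P t → t ω < ∞

/-- Martin-Löf tests with respect to `P`, relative to `O`. -/
def IsMartinLofTest (O : Set (ℕ →. ℕ)) (P : Measure Omega) (U : ℕ → Set Omega) : Prop :=
  UniformlyEffectivelyOpen O wordCylinder U ∧ ∀ i, P (U i) ≤ (2⁻¹ : ℝ≥0∞) ^ i

/-- `ω` passes every Martin-Löf test with respect to `P` relative to `O`. -/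
def IsMartinLofRandom (O : Set (ℕ →. ℕ)) (P : Measure Omega) (ω : Omega) : Prop :=
  ∀ U, IsMartinLofTest O P U → ω ∉ ⋂ i, U i

/-- The oracle that returns the `n`-th digit of the binary sequence `b`. -/
def digitOracle (b : ℕ → Fin 2) : Set (ℕ →. ℕ) :=
  {fun n => Part.some (b n : ℕ)}

/-- `b` is a binary expansion `p = 0.b₀b₁b₂…` of `p`. -/
def IsBinaryExpansion (p : I) (b : ℕ → Fin 2) : Prop :=
  Real.ofDigits b = (p : ℝ)

end BernoulliTests

open BernoulliTests

/-!
A universal uniform test is a weighted supremum of all enumerable families of pieces, each piece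
being a number on a product of a cylinder and a rational interval of parameters. The pieces of a
stage of an enumeration are used on a dyadic cell of parameters only if a decidable overestimate
of the integral of their maximum is at most `2` there. As the cells shrink to a parameter, the
overestimate approaches the integral, so nothing is lost where the integral is at most `1`.

A computation with an expansion of `p` as the oracle reads only finitely many digits. If the
expansion is not eventually constant, `p` is interior to the set of numbers that begin with these
digits, so a `p`-relativized test comes from an enumerable family of pieces near `p`; an eventually
constant expansion is computable. In both cases the slice at `p` of the universal uniform test
dominates the relativized test.

The infimum over `p` of a uniform test is enumerable because `[0,1]` is compact, so a sequence is
Bernoulli exactly if some slice of the universal uniform test is finite on it. A Martin-Löf test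
`U` gives the test `sup_i 2 ^ i * 1_{U (2i+1)}`, and Markov's inequality gives the converse.
-/

namespace BernoulliTests

open Encodable Filter
open Nat.Partrec (Code)

theorem primrec_natPair {α : Type*} [Primcodable α] {f g : α → ℕ} (hf : Primrec f)
    (hg : Primrec g) : Primrec fun a => Nat.pair (f a) (g a) :=
  Primrec₂.natPair.comp hf hg

attribute [local fun_prop] Primrec Primrec.id Primrec.const Primrec.comp Primrec.fst Primrec.snd
  Primrec.pair Primrec.unpair Primrec.encode Primrec.decode primrec_natPair

/-! ### Recursively enumerable predicates -/

section RePred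

variable {α β : Type*} [Primcodable α] [Primcodable β]

theorem rePred_comp {P : β → Prop} {f : α → β} (hP : REPred P) (hf : Computable f) :
    REPred fun a => P (f a) :=
  Partrec.comp hP hf

theorem exists_code_of_rePred {P : α → Prop} (hP : REPred P) :
    ∃ c : Code, ∀ a, P a ↔ ∃ s, (Code.evaln s c (encode a)).isSome := by
  obtain ⟨c, hc⟩ := Code.exists_code.1 hP
  refine ⟨c, fun a => ?_⟩
  have hdom : P a ↔ (Code.eval c (encode a)).Dom := by
    simp [hc, Part.assert]
  simp only [hdom, Part.dom_iff_mem, Code.evaln_complete, Option.isSome_iff_exists,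
    Option.mem_def]
  exact exists_comm

theorem rePred_exists_primrec {P : α → Prop} (hP : REPred P) :
    ∃ D : α → ℕ → Prop, PrimrecRel D ∧ (∀ a s t, s ≤ t → D a s → D a t) ∧
      ∀ a, P a ↔ ∃ s, D a s := by
  obtain ⟨c, hc⟩ := exists_code_of_rePred hP
  refine ⟨fun a s => (Code.evaln s c (encode a)).isSome = true, ?_, fun a s t hst h => ?_, hc⟩
  · have hinput : Primrec fun q : α × ℕ => ((q.2, c), encode q.1) := by fun_prop
    exact Primrec.eq.comp (Primrec.option_isSome.comp (Code.primrec_evaln.comp hinput))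
      (Primrec.const true)
  · obtain ⟨y, hy⟩ := Option.isSome_iff_exists.1 h
    exact Option.isSome_iff_exists.2 ⟨y, Code.evaln_mono hst hy⟩

theorem rePred_exists_of_primrecRel {D : α → ℕ → Prop} (hD : PrimrecRel D) :
    REPred fun a => ∃ s, D a s := by
  classical
  have hsearch : Partrec fun a => Nat.rfind fun n => Part.some (decide (D a n)) :=
    Partrec.rfind (Primrec.to_comp hD.decide).partrec
  exact hsearch.dom_re.of_eq fun a => Nat.rfind_dom'.trans (by simp)

theorem rePred_exists {P : α → β → Prop} (hP : REPred fun q : α × β => P q.1 q.2) :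
    REPred fun a => ∃ b, P a b := by
  obtain ⟨D, hD, -, hPD⟩ := rePred_exists_primrec hP
  have hsearch : PrimrecRel fun (a : α) (n : ℕ) =>
      ∃ b ∈ (decode (α := β) n.unpair.1).toList, D (a, b) n.unpair.2 := by
    have hmem : PrimrecRel fun (b : β) (q : α × ℕ) => D (q.1, b) q.2.unpair.2 :=
      hD.comp (by fun_prop) (by fun_prop)
    exact hmem.exists_mem_list.comp (Primrec.optionToList.comp (by fun_prop)) Primrec.id
  refine (rePred_exists_of_primrecRel hsearch).of_eq fun a => ?_
  simp only [hPD (a, _), Option.mem_toList]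
  constructor
  · rintro ⟨n, b, -, h⟩
    exact ⟨b, _, h⟩
  · rintro ⟨b, s, h⟩
    exact ⟨Nat.pair (encode b) s, b, by simp, by simpa using h⟩

theorem rePred_and {P Q : α → Prop} (hP : REPred P) (hQ : REPred Q) :
    REPred fun a => P a ∧ Q a := by
  obtain ⟨D, hD, hDmono, hPD⟩ := rePred_exists_primrec hP
  obtain ⟨E, hE, hEmono, hQE⟩ := rePred_exists_primrec hQ
  refine (rePred_exists_of_primrecRel (D := fun a s => D a s ∧ E a s)
    (PrimrecPred.and hD hE)).of_eq fun a => ?_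
  rw [hPD, hQE]
  constructor
  · rintro ⟨s, h, h'⟩
    exact ⟨⟨s, h⟩, ⟨s, h'⟩⟩
  · rintro ⟨⟨s, h⟩, ⟨t, h'⟩⟩
    exact ⟨max s t, hDmono _ _ _ (le_max_left _ _) h, hEmono _ _ _ (le_max_right _ _) h'⟩

theorem rePred_or {P Q : α → Prop} (hP : REPred P) (hQ : REPred Q) :
    REPred fun a => P a ∨ Q a := by
  obtain ⟨D, hD, -, hPD⟩ := rePred_exists_primrec hP
  obtain ⟨E, hE, -, hQE⟩ := rePred_exists_primrec hQ
  refine (rePred_exists_of_primrecRel (D := fun a s => D a s ∨ E a s)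
    (PrimrecPred.or hD hE)).of_eq fun a => ?_
  rw [hPD, hQE, exists_or]

theorem rePred_forall_lt {P : α → ℕ → Prop} (hP : REPred fun q : α × ℕ => P q.1 q.2)
    {f : α → ℕ} (hf : Primrec f) : REPred fun a => ∀ n < f a, P a n := by
  obtain ⟨D, hD, hDmono, hPD⟩ := rePred_exists_primrec hP
  have hbounded : PrimrecRel fun (a : α) (s : ℕ) => ∀ n < f a, D (a, n) s := by
    have hmem : PrimrecRel fun (n : ℕ) (q : α × ℕ) => D (q.1, n) q.2 :=
      hD.comp (by fun_prop) (by fun_prop)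
    exact (hmem.forall_mem_list.comp (Primrec.list_range.comp (hf.comp Primrec.fst))
      Primrec.id).of_eq fun q => by simp
  refine (rePred_exists_of_primrecRel hbounded).of_eq fun a => ?_
  simp only [hPD (a, _)]
  constructor
  · rintro ⟨s, h⟩ n hn
    exact ⟨s, h n hn⟩
  · intro h
    choose! steps hsteps using h
    exact ⟨(Finset.range (f a)).sup steps, fun n hn =>
      hDmono _ _ _ (Finset.le_sup (f := steps) (Finset.mem_range.2 hn)) (hsteps n hn)⟩

end RePred

/-! ### Oracles and the use principle -/

section Oracle

variable {α β : Type} [Primcodable α] [Primcodable β] {O : Set (ℕ →. ℕ)}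

theorem rePredIn_empty {P : α → Prop} : REPredIn ∅ P ↔ REPred P :=
  recursiveIn_empty_iff

theorem rePredIn_of_dom {P : α → Prop} {f : ℕ → Part ℕ} (hf : Nat.RecursiveIn O f)
    (hP : ∀ a, P a ↔ (f (encode a)).Dom) : REPredIn O P := by
  have hdecode : Nat.RecursiveIn O fun n =>
      Part.ofOption ((decode (α := α) n).map encode) :=
    Nat.Partrec.recursiveIn (Nat.Partrec.of_eq (Computable.id (α := α)).partrec fun n => by
      cases decode (α := α) n <;> simp)
  refine (Nat.RecursiveIn.comp .zero (hf.comp hdecode)).of_eq fun n => ?_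
  rcases decode (α := α) n with _ | a
  · simp [Part.bind_eq_bind]
  · refine Part.ext' ?_ fun _ _ => rfl
    simp only [Part.bind_eq_bind, Option.map_some, Part.coe_some, Part.bind_some, Part.bind_dom]
    simp [hP, Part.assert, show (0 : Part ℕ).Dom from trivial]

theorem REPredIn.comp {P : β → Prop} {f : α → β} (hP : REPredIn O P) (hf : Computable f) :
    REPredIn O fun a => P (f a) := by
  refine rePredIn_of_dom (Nat.RecursiveIn.comp hP (Nat.Partrec.recursiveIn hf)) fun a => ?_
  simp [Part.assert]

/-- The first `k` terms of a sequence. -/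
def digitPrefix {δ : Type*} (g : ℕ → δ) (k : ℕ) : List δ := (List.range k).map g

theorem length_digitPrefix {δ : Type*} (g : ℕ → δ) (k : ℕ) : (digitPrefix g k).length = k := by
  simp [digitPrefix]

theorem digitPrefix_succ {δ : Type*} (g : ℕ → δ) (k : ℕ) :
    digitPrefix g (k + 1) = digitPrefix g k ++ [g k] := by
  simp [digitPrefix, List.range_succ]

theorem getElem?_digitPrefix {δ : Type*} (g : ℕ → δ) {k n : ℕ} (h : n < k) :
    (digitPrefix g k)[n]? = some (g n) := by
  simp [digitPrefix, h]

/-- The set of oracles whose only member is the total function `g`. -/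
def totalOracle (g : ℕ → ℕ) : Set (ℕ →. ℕ) := {fun n => Part.some (g n)}

/-- The family `F` approximates the partial function `f` along the prefixes of `g`: a computation
of `F` that is given a prefix of `g` only returns values of `f`, and it returns every value of `f`
once the prefix is long enough. -/
structure PrefixApprox (g : ℕ → ℕ) (F : List ℕ → ℕ → Part ℕ) (f : ℕ → Part ℕ) : Prop where
  partrec : Partrec fun q : List ℕ × ℕ => F q.1 q.2
  sound : ∀ {k n y}, y ∈ F (digitPrefix g k) n → y ∈ f n
  complete : ∀ {n y}, y ∈ f n → ∀ᶠ k in atTop, y ∈ F (digitPrefix g k) n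

namespace PrefixApprox

variable {g : ℕ → ℕ} {F H : List ℕ → ℕ → Part ℕ} {f h : ℕ → Part ℕ}

theorem dom_iff (hf : PrefixApprox g F f) {n : ℕ} :
    (f n).Dom ↔ ∃ k, (F (digitPrefix g k) n).Dom := by
  simp only [Part.dom_iff_mem]
  constructor
  · rintro ⟨y, hy⟩
    obtain ⟨k, hk⟩ := (hf.complete hy).exists
    exact ⟨k, y, hk⟩
  · rintro ⟨k, y, hy⟩
    exact ⟨y, hf.sound hy⟩

theorem of_partrec (hf : Nat.Partrec f) : PrefixApprox g (fun _ => f) f where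
  partrec := (Partrec.nat_iff.2 hf).comp Computable.snd
  sound := id
  complete hy := .of_forall fun _ => hy

theorem oracle : PrefixApprox g (fun τ n => (τ[n]? : Part ℕ)) (fun n => Part.some (g n)) where
  partrec := Computable.ofOption Computable.list_getElem?
  sound {k n y} hy := by
    rcases lt_or_ge n k with hn | hn
    · simpa [getElem?_digitPrefix g hn] using hy
    · rw [List.getElem?_eq_none (by rwa [length_digitPrefix])] at hy
      exact absurd hy (Part.notMem_none y)
  complete {n y} hy := by
    filter_upwards [eventually_gt_atTop n] with k hk
    simpa [getElem?_digitPrefix g hk] using hy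

theorem pair (hf : PrefixApprox g F f) (hh : PrefixApprox g H h) :
    PrefixApprox g (fun τ n => (F τ n).bind fun y => (H τ n).map (Nat.pair y))
      (fun n => Nat.pair <$> f n <*> h n) where
  partrec := by
    have hpair : Primrec fun q : ((List ℕ × ℕ) × ℕ) × ℕ => Nat.pair q.1.2 q.2 := by fun_prop
    exact Partrec.bind hf.partrec <| .to₂ <| Partrec.map (hh.partrec.comp Computable.fst)
      hpair.to_comp.to₂
  sound := by
    simp only [Part.mem_bind_iff, Part.mem_map_iff, Seq.seq, Part.map_eq_map]
    rintro k n z ⟨y, hy, w, hw, rfl⟩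
    exact ⟨_, ⟨y, hf.sound hy, rfl⟩, w, hh.sound hw, rfl⟩
  complete := by
    simp only [Part.mem_bind_iff, Part.mem_map_iff, Seq.seq, Part.map_eq_map]
    rintro n z ⟨_, ⟨y, hy, rfl⟩, w, hw, rfl⟩
    filter_upwards [hf.complete hy, hh.complete hw] with k hyk hwk
    exact ⟨y, hyk, w, hwk, rfl⟩

theorem comp (hf : PrefixApprox g F f) (hh : PrefixApprox g H h) :
    PrefixApprox g (fun τ n => (H τ n).bind (F τ)) (fun n => h n >>= f) where
  partrec := Partrec.bind hh.partrec (hf.partrec.comp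
    (Computable.pair (Computable.fst.comp Computable.fst) Computable.snd)).to₂
  sound := by
    simp only [Part.mem_bind_iff, Part.bind_eq_bind]
    rintro k n z ⟨y, hy, hz⟩
    exact ⟨y, hh.sound hy, hf.sound hz⟩
  complete := by
    simp only [Part.mem_bind_iff, Part.bind_eq_bind]
    rintro n z ⟨y, hy, hz⟩
    filter_upwards [hh.complete hy, hf.complete hz] with k hyk hzk
    exact ⟨y, hyk, hzk⟩

theorem prec (hf : PrefixApprox g F f) (hh : PrefixApprox g H h) :
    PrefixApprox g
      (fun τ p => Nat.rec (F τ p.unpair.1)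
        (fun y IH => IH.bind fun i => H τ (Nat.pair p.unpair.1 (Nat.pair y i))) p.unpair.2)
      (fun p => Nat.rec (f p.unpair.1)
        (fun y IH => IH.bind fun i => h (Nat.pair p.unpair.1 (Nat.pair y i))) p.unpair.2) where
  partrec := by
    have hfst : Primrec fun q : List ℕ × ℕ => (q.1, q.2.unpair.1) := by fun_prop
    have hargs : Primrec fun q : (List ℕ × ℕ) × ℕ × ℕ =>
        (q.1.1, Nat.pair q.1.2.unpair.1 (Nat.pair q.2.1 q.2.2)) := by fun_prop
    exact Partrec.nat_rec (Computable.snd.comp (Computable.unpair.comp Computable.snd))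
      (hf.partrec.comp hfst.to_comp) (hh.partrec.comp hargs.to_comp).to₂
  sound {k p} := by
    induction p.unpair.2 with
    | zero => exact hf.sound
    | succ n ih =>
      intro z
      simp only [Part.mem_bind_iff]
      rintro ⟨y, hy, hz⟩
      exact ⟨y, ih hy, hh.sound hz⟩
  complete {p} := by
    induction p.unpair.2 with
    | zero => exact hf.complete
    | succ n ih =>
      intro z
      simp only [Part.mem_bind_iff]
      rintro ⟨y, hy, hz⟩
      filter_upwards [ih hy, hh.complete hz] with k hyk hzk
      exact ⟨y, hyk, hzk⟩

theorem rfind (hf : PrefixApprox g F f) :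
    PrefixApprox g
      (fun τ a => Nat.rfind fun n => (fun m => decide (m = 0)) <$> F τ (Nat.pair a n))
      (fun a => Nat.rfind fun n => (fun m => decide (m = 0)) <$> f (Nat.pair a n)) where
  partrec := by
    have hargs : Primrec fun q : (List ℕ × ℕ) × ℕ => (q.1.1, Nat.pair q.1.2 q.2) := by fun_prop
    exact Partrec.rfind <| .to₂ <| Partrec.map (hf.partrec.comp hargs.to_comp)
      (Primrec.eq.comp Primrec.snd (Primrec.const 0)).decide.to_comp.to₂
  sound {k a n} hn := by
    obtain ⟨hzero, hpos⟩ := Nat.mem_rfind.1 hn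
    refine Nat.mem_rfind.2 ⟨?_, fun hm => ?_⟩
    · obtain ⟨y, hy, hy0⟩ := (Part.mem_map_iff _).1 hzero
      exact (Part.mem_map_iff _).2 ⟨y, hf.sound hy, hy0⟩
    · obtain ⟨z, hz, hz0⟩ := (Part.mem_map_iff _).1 (hpos hm)
      exact (Part.mem_map_iff _).2 ⟨z, hf.sound hz, hz0⟩
  complete {a n} hn := by
    obtain ⟨hzero, hpos⟩ := Nat.mem_rfind.1 hn
    obtain ⟨y, hy, hy0⟩ := (Part.mem_map_iff _).1 hzero
    have hbelow : ∀ᶠ k in atTop, ∀ m ∈ Set.Iio n,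
        false ∈ Part.map (fun m => decide (m = 0)) (F (digitPrefix g k) (Nat.pair a m)) := by
      refine (Filter.eventually_all_finite (Set.finite_Iio n)).2 fun m hm => ?_
      obtain ⟨z, hz, hz0⟩ := (Part.mem_map_iff _).1 (hpos hm)
      filter_upwards [hf.complete hz] with k hk
      exact (Part.mem_map_iff _).2 ⟨z, hk, hz0⟩
    filter_upwards [hf.complete hy, hbelow] with k hyk hk
    exact Nat.mem_rfind.2 ⟨(Part.mem_map_iff _).2 ⟨y, hyk, hy0⟩, fun hm => hk _ hm⟩

end PrefixApprox

theorem exists_prefixApprox {g : ℕ → ℕ} {f : ℕ →. ℕ} (hf : Nat.RecursiveIn (totalOracle g) f) :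
    ∃ F, PrefixApprox g F f := by
  induction hf with
  | zero => exact ⟨_, .of_partrec .zero⟩
  | succ => exact ⟨_, .of_partrec .succ⟩
  | left => exact ⟨_, .of_partrec .left⟩
  | right => exact ⟨_, .of_partrec .right⟩
  | oracle h hh =>
    obtain rfl := Set.mem_singleton_iff.1 hh
    exact ⟨_, .oracle⟩
  | pair _ _ ihf ihh =>
    obtain ⟨F, hF⟩ := ihf
    obtain ⟨H, hH⟩ := ihh
    exact ⟨_, hF.pair hH⟩
  | comp _ _ ihf ihh =>
    obtain ⟨F, hF⟩ := ihf
    obtain ⟨H, hH⟩ := ihh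
    exact ⟨_, hF.comp hH⟩
  | prec _ _ ihf ihh =>
    obtain ⟨F, hF⟩ := ihf
    obtain ⟨H, hH⟩ := ihh
    exact ⟨_, hF.prec hH⟩
  | rfind _ ihf =>
    obtain ⟨F, hF⟩ := ihf
    exact ⟨_, hF.rfind⟩

theorem recursiveIn_encode_digitPrefix (g : ℕ → ℕ) :
    Nat.RecursiveIn (totalOracle g) fun k => Part.some (encode (digitPrefix g k)) := by
  have happend : Nat.Primrec fun n : ℕ =>
      encode (((decode (α := List ℕ) n.unpair.1).getD []) ++ [n.unpair.2]) :=
    Primrec.nat_iff.1 (Primrec.encode.comp (Primrec.list_concat.comp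
      (Primrec.option_getD.comp (by fun_prop) (Primrec.const [])) (by fun_prop)))
  have hstep : Nat.RecursiveIn (totalOracle g) fun n => Part.some (encode
      (((decode (α := List ℕ) n.unpair.2.unpair.2).getD []) ++ [g n.unpair.2.unpair.1])) := by
    refine (happend.recursiveIn.comp (.pair (.comp .right .right)
      ((Nat.RecursiveIn.oracle _ (Set.mem_singleton _)).comp (.comp .left .right)))).of_eq
        fun n => ?_
    simp [Seq.seq]
  have hzero : Nat.RecursiveIn (totalOracle g) fun k => Part.some (Nat.pair 0 k) :=
    (Primrec.nat_iff.1 (by fun_prop)).recursiveIn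
  have hbase : Nat.RecursiveIn (totalOracle g) fun _ => Part.some (encode ([] : List ℕ)) :=
    (Nat.Primrec.const _).recursiveIn
  refine ((Nat.RecursiveIn.prec hbase hstep).comp hzero).of_eq fun k => ?_
  simp only [Part.bind_eq_bind, Part.bind_some, Nat.unpair_pair]
  induction k with
  | zero => rfl
  | succ k ih =>
    simp only [ih, Part.bind_some, encodek, Option.getD_some, digitPrefix_succ]

theorem rePredIn_exists_digitPrefix (g : ℕ → ℕ) {V : List ℕ × α → Prop} (hV : REPred V) :
    REPredIn (totalOracle g) fun a => ∃ k, V (digitPrefix g k, a) := by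
  obtain ⟨c, hc⟩ := exists_code_of_rePred hV
  let test : ℕ → ℕ := fun w => if (Code.evaln w.unpair.2.unpair.2.unpair.2 c
    (Nat.pair w.unpair.1 w.unpair.2.unpair.1)).isSome = true then 0 else 1
  have htest : Nat.Primrec test := by
    have hinput : Primrec fun w : ℕ =>
        ((w.unpair.2.unpair.2.unpair.2, c), Nat.pair w.unpair.1 w.unpair.2.unpair.1) := by
      fun_prop
    exact Primrec.nat_iff.1 (Primrec.ite (Primrec.eq.comp (Primrec.option_isSome.comp
      (Code.primrec_evaln.comp hinput)) (Primrec.const true)) (Primrec.const 0) (Primrec.const 1))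
  have hsearch : Nat.RecursiveIn (totalOracle g) fun w => Part.some (test (Nat.pair
      (encode (digitPrefix g w.unpair.2.unpair.1)) w)) := by
    refine (htest.recursiveIn.comp (.pair ((recursiveIn_encode_digitPrefix g).comp
      (.comp .left .right)) Nat.Primrec.id.recursiveIn)).of_eq fun n => ?_
    simp [Seq.seq]
  refine rePredIn_of_dom hsearch.rfind fun a => Iff.trans ?_ Nat.rfind_dom'.symm
  have hV_iff : (∃ k, V (digitPrefix g k, a)) ↔ ∃ m : ℕ, (Code.evaln m.unpair.2 c
      (Nat.pair (encode (digitPrefix g m.unpair.1)) (encode a))).isSome := by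
    simp only [hc, encode_prod_val]
    exact ⟨fun ⟨k, s, h⟩ => ⟨Nat.pair k s, by simpa using h⟩, fun ⟨m, h⟩ => ⟨_, _, h⟩⟩
  simp [hV_iff, test, Option.isSome_iff_ne_none]

theorem rePredIn_totalOracle_iff {g : ℕ → ℕ} {P : α → Prop} :
    REPredIn (totalOracle g) P ↔
      ∃ V : List ℕ × α → Prop, REPred V ∧ ∀ a, P a ↔ ∃ k, V (digitPrefix g k, a) := by
  constructor
  · intro hP
    obtain ⟨F, hF⟩ := exists_prefixApprox hP
    refine ⟨fun q => (F q.1 (encode q.2)).Dom, Partrec.dom_re (hF.partrec.comp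
      (Computable.pair Computable.fst (Computable.encode.comp Computable.snd))), fun a => ?_⟩
    simpa [Part.assert] using hF.dom_iff (n := encode a)
  · rintro ⟨V, hV, hPV⟩
    exact (funext fun a => propext (hPV a) : P = _) ▸ rePredIn_exists_digitPrefix g hV

theorem REPredIn.exists {g : ℕ → ℕ} {P : α → β → Prop}
    (hP : REPredIn (totalOracle g) fun q : α × β => P q.1 q.2) :
    REPredIn (totalOracle g) fun a => ∃ b, P a b := by
  obtain ⟨V, hV, hPV⟩ := rePredIn_totalOracle_iff.1 hP
  refine rePredIn_totalOracle_iff.2 ⟨fun q => ∃ b, V (q.1, q.2, b), ?_, fun a => ?_⟩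
  · exact rePred_exists (rePred_comp hV (Primrec.to_comp (by fun_prop)))
  · simp only [hPV (a, _)]
    exact exists_comm

theorem REPredIn.and_rePred {g : ℕ → ℕ} {P Q : α → Prop} (hP : REPredIn (totalOracle g) P)
    (hQ : REPred Q) : REPredIn (totalOracle g) fun a => P a ∧ Q a := by
  obtain ⟨V, hV, hPV⟩ := rePredIn_totalOracle_iff.1 hP
  refine rePredIn_totalOracle_iff.2 ⟨fun q => V q ∧ Q q.2, ?_, fun a => ?_⟩
  · exact rePred_and hV (rePred_comp hQ Computable.snd)
  · simp only [hPV, exists_and_right]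

theorem REPredIn.or_rePred {g : ℕ → ℕ} {P Q : α → Prop} (hP : REPredIn (totalOracle g) P)
    (hQ : REPred Q) : REPredIn (totalOracle g) fun a => P a ∨ Q a := by
  obtain ⟨V, hV, hPV⟩ := rePredIn_totalOracle_iff.1 hP
  refine rePredIn_totalOracle_iff.2 ⟨fun q => V q ∨ Q q.2, ?_, fun a => ?_⟩
  · exact rePred_or hV (rePred_comp hQ Computable.snd)
  · simp only [hPV, exists_or, exists_const]

theorem rePredIn_digitOracle_iff {b : ℕ → Fin 2} {P : α → Prop} :
    REPredIn (digitOracle b) P ↔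
      ∃ V : List (Fin 2) × α → Prop, REPred V ∧ ∀ a, P a ↔ ∃ k, V (digitPrefix b k, a) := by
  refine (rePredIn_totalOracle_iff (g := fun n => (b n : ℕ))).trans ⟨?_, ?_⟩
  · rintro ⟨V, hV, hPV⟩
    have hval : Primrec fun q : List (Fin 2) × α => (q.1.map Fin.val, q.2) :=
      (Primrec.list_map Primrec.fst (Primrec.fin_val.comp Primrec.snd).to₂).pair Primrec.snd
    refine ⟨fun q => V (q.1.map Fin.val, q.2), rePred_comp hV hval.to_comp, fun a => ?_⟩
    simp [hPV, digitPrefix, Function.comp_def]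
  · rintro ⟨V, hV, hPV⟩
    let digit : ℕ → Fin 2 := fun n => if n = 1 then 1 else 0
    have hdigit : Primrec digit := Primrec.ite (Primrec.eq.comp Primrec.id (Primrec.const 1))
      (Primrec.const 1) (Primrec.const 0)
    have hdigits : Primrec fun q : List ℕ × α => (q.1.map digit, q.2) :=
      (Primrec.list_map Primrec.fst (hdigit.comp Primrec.snd).to₂).pair Primrec.snd
    have hval (d : Fin 2) : digit d = d := by
      fin_cases d <;> rfl
    refine ⟨fun q => V (q.1.map digit, q.2), rePred_comp hV hdigits.to_comp, fun a => ?_⟩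
    simp [hPV, digitPrefix, Function.comp_def, hval]

end Oracle

/-! ### Words and Bernoulli measures -/

theorem digitPrefix_eq_ofFn {δ : Type*} (g : ℕ → δ) (k : ℕ) :
    digitPrefix g k = List.ofFn fun i : Fin k => g i := by
  apply List.ext_getElem <;> simp [digitPrefix]

theorem take_digitPrefix {δ : Type*} (g : ℕ → δ) {k l : ℕ} (h : k ≤ l) :
    (digitPrefix g l).take k = digitPrefix g k := by
  simp [digitPrefix, ← List.map_take, List.take_range, h]

theorem mem_wordCylinder_iff {ω : Omega} {x : List Bool} :
    ω ∈ wordCylinder x ↔ digitPrefix ω x.length = x := by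
  rw [digitPrefix_eq_ofFn]
  constructor
  · intro h
    refine List.ext_getElem (by simp) fun i _ hi => ?_
    simpa using h ⟨i, hi⟩
  · intro h i
    simpa using congrArg (fun l : List Bool => l[(i : ℕ)]?) h

theorem isPrefix_digitPrefix_iff {ω : Omega} {x : List Bool} {s : ℕ} :
    x <+: digitPrefix ω s ↔ x.length ≤ s ∧ ω ∈ wordCylinder x := by
  rw [mem_wordCylinder_iff]
  constructor
  · intro h
    have hlen : x.length ≤ s := by simpa [length_digitPrefix] using h.length_le
    rw [List.prefix_iff_eq_take, take_digitPrefix _ hlen] at h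
    exact ⟨hlen, h.symm⟩
  · rintro ⟨hlen, h⟩
    rw [List.prefix_iff_eq_take, take_digitPrefix _ hlen, h]

theorem measurableSet_wordCylinder (x : List Bool) : MeasurableSet (wordCylinder x) := by
  have : wordCylinder x = ⋂ i : Fin x.length, (fun ω : Omega => ω i) ⁻¹' {x.get i} := by
    ext ω
    simp [wordCylinder]
  rw [this]
  exact MeasurableSet.iInter fun i => measurable_pi_apply _ (MeasurableSet.singleton _)

/-- The probability of the digit `d` when `1` has probability `p`. -/
def digitProb (p : ℝ) (d : Bool) : ℝ := if d then p else 1 - p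

/-- The probability `B_p(xΩ)`. -/
def wordProb (p : ℝ) (x : List Bool) : ℝ := (x.map (digitProb p)).prod

theorem digitProb_nonneg (p : I) (d : Bool) : 0 ≤ digitProb p d := by
  cases d <;> simp [digitProb, p.2.1, p.2.2]

theorem wordProb_nonneg (p : I) (x : List Bool) : 0 ≤ wordProb p x :=
  List.prod_nonneg fun _ h => by
    obtain ⟨d, -, rfl⟩ := List.mem_map.1 h
    exact digitProb_nonneg p d

theorem bernoulliMeasure_singleton (p : I) (d : Bool) :
    bernoulliMeasure true false p {d} = ENNReal.ofReal (digitProb p d) := by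
  rw [bernoulliMeasure_apply p (MeasurableSet.singleton d)]
  cases d <;> simp [digitProb, ← ENNReal.ofReal_coe_nnreal]

theorem bernoulliProd_wordCylinder (p : I) (x : List Bool) :
    bernoulliProd p (wordCylinder x) = ENNReal.ofReal (wordProb p x) := by
  have hbox : wordCylinder x = Set.pi (Finset.range x.length) fun i => {x.getD i false} := by
    ext ω
    simp only [wordCylinder, Set.mem_ofPred_eq, Set.mem_pi, Finset.coe_range, Set.mem_Iio,
      Set.mem_singleton_iff]
    constructor
    · intro h i hi
      simpa [hi] using h ⟨i, hi⟩
    · intro h i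
      simpa using h i i.2
  rw [hbox, bernoulliProd, Measure.infinitePi_pi _ (fun i _ => MeasurableSet.singleton _)]
  simp only [bernoulliMeasure_singleton]
  rw [← ENNReal.ofReal_prod_of_nonneg fun i _ => digitProb_nonneg p _, Finset.prod_range,
    wordProb, ← Fin.prod_univ_fun_getElem]
  simp

instance (p : I) : IsProbabilityMeasure (bernoulliProd p) := by
  unfold bernoulliProd
  infer_instance

/-- The list of all binary words of length `s`. -/
def words : ℕ → List (List Bool)
  | 0 => [[]]
  | s + 1 => (words s).map (true :: ·) ++ (words s).map (false :: ·)

theorem mem_words_iff {s : ℕ} {y : List Bool} : y ∈ words s ↔ y.length = s := by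
  induction s generalizing y with
  | zero => simp [words]
  | succ s ih =>
    rcases y with _ | ⟨d, y⟩
    · simp [words]
    · cases d <;> simp [words, ih]

theorem nodup_words (s : ℕ) : (words s).Nodup := by
  induction s with
  | zero => simp [words]
  | succ s ih =>
    refine List.Nodup.append (ih.map List.cons_injective) (ih.map List.cons_injective) ?_
    simp [List.disjoint_left]

theorem comp_digitPrefix_eq_sum_indicator (φ : List Bool → ℝ≥0∞) (s : ℕ) (ω : Omega) :
    φ (digitPrefix ω s) =
      ∑ y ∈ (words s).toFinset, (wordCylinder y).indicator (fun _ => φ y) ω := by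
  have hprefix : digitPrefix ω s ∈ (words s).toFinset := by
    simp [mem_words_iff, length_digitPrefix]
  rw [Finset.sum_eq_single_of_mem _ hprefix fun y hy hne => ?_]
  · rw [Set.indicator_of_mem (by rw [mem_wordCylinder_iff, length_digitPrefix])]
  · rw [List.mem_toFinset, mem_words_iff] at hy
    rw [Set.indicator_of_notMem]
    rw [mem_wordCylinder_iff, hy]
    exact hne.symm

theorem measurable_comp_digitPrefix (φ : List Bool → ℝ≥0∞) (s : ℕ) :
    Measurable fun ω : Omega => φ (digitPrefix ω s) := by
  simp only [comp_digitPrefix_eq_sum_indicator φ s]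
  exact Finset.measurable_fun_sum _ fun y _ =>
    measurable_const.indicator (measurableSet_wordCylinder y)

theorem lintegral_comp_digitPrefix (p : I) (φ : List Bool → ℕ) (s : ℕ) :
    ∫⁻ ω, (φ (digitPrefix ω s) : ℝ≥0∞) ∂(bernoulliProd p) =
      ENNReal.ofReal ((words s).map fun y => wordProb p y * φ y).sum := by
  have hnonneg : ∀ y, 0 ≤ wordProb p y * φ y := fun y =>
    mul_nonneg (wordProb_nonneg p y) (Nat.cast_nonneg _)
  simp only [comp_digitPrefix_eq_sum_indicator fun y => (φ y : ℝ≥0∞)]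
  rw [lintegral_finsetSum _ fun y _ =>
    measurable_const.indicator (measurableSet_wordCylinder y), ← List.sum_toFinset _
    (nodup_words s), ENNReal.ofReal_sum_of_nonneg fun y _ => hnonneg y]
  refine Finset.sum_congr rfl fun y _ => ?_
  rw [lintegral_indicator_const (measurableSet_wordCylinder y), bernoulliProd_wordCylinder,
    ENNReal.ofReal_mul (wordProb_nonneg p y), ENNReal.ofReal_natCast, mul_comm]

/-! ### Rational intervals and dyadic cells -/

theorem primrec_add {α : Type*} [Primcodable α] {f g : α → ℕ} (hf : Primrec f)
    (hg : Primrec g) : Primrec fun a => f a + g a :=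
  Primrec.nat_add.comp hf hg

theorem primrec_mul {α : Type*} [Primcodable α] {f g : α → ℕ} (hf : Primrec f)
    (hg : Primrec g) : Primrec fun a => f a * g a :=
  Primrec.nat_mul.comp hf hg

theorem primrec_sub {α : Type*} [Primcodable α] {f g : α → ℕ} (hf : Primrec f)
    (hg : Primrec g) : Primrec fun a => f a - g a :=
  Primrec.nat_sub.comp hf hg

theorem primrec_pow {α : Type*} [Primcodable α] {f g : α → ℕ} (hf : Primrec f)
    (hg : Primrec g) : Primrec fun a => f a ^ g a :=
  (Primrec₂.unpaired'.1 Nat.Primrec.pow).comp hf hg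

attribute [local fun_prop] primrec_add primrec_mul primrec_sub primrec_pow

theorem ratOf_lt_iff {r r' : RatCode} : ratOf r < ratOf r' ↔
    r.1 * (r'.2.2 + 1) + r'.2.1 * (r.2.2 + 1) < r'.1 * (r.2.2 + 1) + r.2.1 * (r'.2.2 + 1) := by
  rw [ratOf, ratOf, div_lt_div_iff₀ (by positivity) (by positivity), ← Nat.cast_lt (α := ℚ)]
  push_cast
  constructor <;> intro h <;> linarith

theorem primrecRel_ratOf_lt : PrimrecRel fun r r' : RatCode => ratOf r < ratOf r' :=
  (Primrec.nat_lt.comp (by fun_prop) (by fun_prop)).of_eq fun q : RatCode × RatCode =>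
    (ratOf_lt_iff (r := q.1) (r' := q.2)).symm

theorem primrecRel_ratOf_le : PrimrecRel fun r r' : RatCode => ratOf r ≤ ratOf r' :=
  (PrimrecPred.not (primrecRel_ratOf_lt.comp Primrec.snd Primrec.fst)).of_eq
    fun _ => not_lt

theorem exists_ratOf_eq (q : ℚ) : ∃ r, ratOf r = q := by
  refine ⟨(q.num.toNat, (-q.num).toNat, q.den - 1), ?_⟩
  have hnum : ((q.num.toNat : ℚ) - ((-q.num).toNat : ℚ)) = (q.num : ℚ) := by
    exact_mod_cast Int.toNat_sub_toNat_neg q.num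
  have hden : ((q.den - 1 : ℕ) : ℚ) + 1 = q.den := by
    rw [Nat.cast_sub q.den_pos]
    simp
  rw [ratOf, hnum, hden, Rat.num_div_den]

/-- A code of `a / 2 ^ m`. -/
def dyadicCode (a m : ℕ) : RatCode := (a, 0, 2 ^ m - 1)

theorem coe_ratOf_dyadicCode (a m : ℕ) : (ratOf (dyadicCode a m) : ℝ) = a / 2 ^ m := by
  simp [ratOf, dyadicCode, Nat.cast_sub Nat.one_le_two_pow]

theorem lt_coe_ennreal_iff {r : ℝ} {x : ℝ≥0∞} :
    (r : EReal) < (x : EReal) ↔ r < 0 ∨ ENNReal.ofReal r < x := by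
  rcases lt_or_ge r 0 with h | h
  · simp only [h, true_or, iff_true]
    exact lt_of_lt_of_le (by exact_mod_cast h) (EReal.coe_ennreal_nonneg x)
  · have hr : (r : EReal) = ((ENNReal.ofReal r : ℝ≥0∞) : EReal) := by
      rw [EReal.coe_ennreal_ofReal, max_eq_left h]
    rw [hr, EReal.coe_ennreal_lt_coe_ennreal_iff]
    simp [not_lt.2 h]

theorem ratOf_lt_natCast_mul_iff {r : RatCode} {a m : ℕ} :
    ((ratOf r : ℝ) : EReal) < (((a : ℝ≥0∞) * 2⁻¹ ^ m : ℝ≥0∞) : EReal) ↔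
      ratOf r < ratOf (dyadicCode a m) := by
  have hcode : (a : ℝ≥0∞) * 2⁻¹ ^ m = ENNReal.ofReal (ratOf (dyadicCode a m) : ℝ) := by
    rw [coe_ratOf_dyadicCode, ENNReal.ofReal_div_of_pos (by positivity), ENNReal.ofReal_natCast,
      ENNReal.ofReal_pow (by norm_num), div_eq_mul_inv, ENNReal.inv_pow]
    simp
  have hnonneg : (0 : ℝ) ≤ ratOf (dyadicCode a m) := by
    rw [coe_ratOf_dyadicCode]
    positivity
  rw [hcode, EReal.coe_ennreal_ofReal, max_eq_left hnonneg, EReal.coe_lt_coe_iff, Rat.cast_lt]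

/-- The open interval whose ends are coded by `J`. -/
def openInterval (J : RatCode × RatCode) : Set ℝ := Set.Ioo (ratOf J.1 : ℝ) (ratOf J.2)

/-- The closed interval whose ends are coded by `J`. -/
def closedInterval (J : RatCode × RatCode) : Set ℝ := Set.Icc (ratOf J.1 : ℝ) (ratOf J.2)

theorem openInterval_subset_closedInterval (J : RatCode × RatCode) :
    openInterval J ⊆ closedInterval J :=
  Set.Ioo_subset_Icc_self

/-- The decidable form of `closedInterval J ⊆ openInterval K`. -/
def Inside (J K : RatCode × RatCode) : Prop := ratOf K.1 < ratOf J.1 ∧ ratOf J.2 < ratOf K.2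

/-- The decidable form of `(closedInterval J ∩ closedInterval K).Nonempty`, for intervals that are
not empty themselves. -/
def Meets (J K : RatCode × RatCode) : Prop := ratOf J.1 ≤ ratOf K.2 ∧ ratOf K.1 ≤ ratOf J.2

instance (J : RatCode × RatCode) : DecidablePred (Meets J) :=
  fun _ => inferInstanceAs (Decidable (_ ∧ _))

theorem Inside.closedInterval_subset {J K : RatCode × RatCode} (h : Inside J K) :
    closedInterval J ⊆ openInterval K := fun _ hp =>
  ⟨(Rat.cast_lt.2 h.1).trans_le hp.1, hp.2.trans_lt (Rat.cast_lt.2 h.2)⟩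

theorem meets_of_mem {J K : RatCode × RatCode} {p : ℝ} (hJ : p ∈ closedInterval J)
    (hK : p ∈ closedInterval K) : Meets J K :=
  ⟨by exact_mod_cast hJ.1.trans hK.2, by exact_mod_cast hK.1.trans hJ.2⟩

theorem primrecRel_inside : PrimrecRel Inside :=
  PrimrecPred.and (primrecRel_ratOf_lt.comp (by fun_prop) (by fun_prop))
    (primrecRel_ratOf_lt.comp (by fun_prop) (by fun_prop))

theorem primrecRel_meets : PrimrecRel Meets :=
  PrimrecPred.and (primrecRel_ratOf_le.comp (by fun_prop) (by fun_prop))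
    (primrecRel_ratOf_le.comp (by fun_prop) (by fun_prop))

theorem rePred_exists_inside {α β : Type*} [Primcodable α] [Primcodable β] {W : α → β → Prop}
    (hW : REPred fun q : α × β => W q.1 q.2) {f : α → RatCode × RatCode}
    {g : β → RatCode × RatCode} (hf : Primrec f) (hg : Primrec g) :
    REPred fun a => ∃ b, W a b ∧ Inside (f a) (g b) := by
  have hinside : PrimrecPred fun q : α × β => Inside (f q.1) (g q.2) :=
    primrecRel_inside.comp (hf.comp Primrec.fst) (hg.comp Primrec.snd)
  exact rePred_exists (rePred_and hW hinside.computablePred.to_re)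

/-- The dyadic interval with center `j / 2 ^ m` and radius `1 / 2 ^ m`, for `d = (m, j)`. -/
def cell (d : ℕ × ℕ) : RatCode × RatCode := ((d.2, 1, 2 ^ d.1 - 1), dyadicCode (d.2 + 1) d.1)

theorem coe_ratOf_cell_fst (m j : ℕ) : (ratOf (cell (m, j)).1 : ℝ) = (j - 1) / 2 ^ m := by
  simp [ratOf, cell, Nat.cast_sub Nat.one_le_two_pow]

theorem coe_ratOf_cell_snd (m j : ℕ) : (ratOf (cell (m, j)).2 : ℝ) = (j + 1) / 2 ^ m := by
  simp [cell, coe_ratOf_dyadicCode]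

theorem primrec_dyadicCode {α : Type*} [Primcodable α] {f g : α → ℕ} (hf : Primrec f)
    (hg : Primrec g) : Primrec fun a => dyadicCode (f a) (g a) := by
  simp only [dyadicCode]
  fun_prop

theorem primrec_cell : Primrec cell :=
  Primrec.pair (by fun_prop) (primrec_dyadicCode (by fun_prop) (by fun_prop))

attribute [local fun_prop] primrec_dyadicCode primrec_cell

theorem exists_mem_openInterval_cell {p : ℝ} (hp : 0 ≤ p) (m : ℕ) :
    ∃ j, p ∈ openInterval (cell (m, j)) := by
  have hfloor := Nat.floor_le (show 0 ≤ p * 2 ^ m by positivity)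
  refine ⟨⌊p * 2 ^ m⌋₊, ?_, ?_⟩
  · rw [coe_ratOf_cell_fst, div_lt_iff₀ (by positivity)]
    linarith
  · rw [coe_ratOf_cell_snd, lt_div_iff₀ (by positivity)]
    exact Nat.lt_floor_add_one _

theorem tendsto_two_mul_inv_two_pow :
    Tendsto (fun m : ℕ => 2 * ((2 : ℝ) ^ m)⁻¹) atTop (nhds 0) := by
  simpa using (tendsto_inv_atTop_zero.comp
    (tendsto_pow_atTop_atTop_of_one_lt (one_lt_two (α := ℝ)))).const_mul 2

theorem eventually_lt_cell_lt {a b p : ℝ} (ha : a < p) (hb : p < b) :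
    ∀ᶠ m in atTop, ∀ j, p ∈ closedInterval (cell (m, j)) →
      a < ratOf (cell (m, j)).1 ∧ (ratOf (cell (m, j)).2 : ℝ) < b := by
  filter_upwards [tendsto_two_mul_inv_two_pow.eventually (gt_mem_nhds (sub_pos.2 ha)),
    tendsto_two_mul_inv_two_pow.eventually (gt_mem_nhds (sub_pos.2 hb))] with m hma hmb j hp
  have hwidth : (ratOf (cell (m, j)).2 : ℝ) - ratOf (cell (m, j)).1 = 2 * ((2 : ℝ) ^ m)⁻¹ := by
    rw [coe_ratOf_cell_fst, coe_ratOf_cell_snd]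
    ring
  constructor <;> linarith [hp.1, hp.2]

theorem eventually_inside_cell {J : RatCode × RatCode} {p : ℝ} (hp : p ∈ openInterval J) :
    ∀ᶠ m in atTop, ∀ j, p ∈ closedInterval (cell (m, j)) → Inside (cell (m, j)) J := by
  filter_upwards [eventually_lt_cell_lt hp.1 hp.2] with m hm j hj
  exact_mod_cast hm j hj

theorem eventually_not_meets_cell {J : RatCode × RatCode} {p : ℝ} (hp : p ∉ closedInterval J) :
    ∀ᶠ m in atTop, ∀ j, p ∈ closedInterval (cell (m, j)) → ¬Meets (cell (m, j)) J := by
  simp only [Meets, not_and_or, not_le]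
  rw [closedInterval, Set.mem_Icc, not_and_or, not_le, not_le] at hp
  rcases hp with hp | hp
  · filter_upwards [eventually_lt_cell_lt (sub_one_lt p) hp] with m hm j hj
    exact .inr (by exact_mod_cast (hm j hj).2)
  · filter_upwards [eventually_lt_cell_lt hp (lt_add_one p)] with m hm j hj
    exact .inl (by exact_mod_cast (hm j hj).1)

/-! ### Finite families of pieces -/

theorem primrec_sum_map {α β : Type*} [Primcodable α] [Primcodable β] {l : α → List β}
    {f : α → β → ℕ} (hl : Primrec l) (hf : Primrec₂ f) :
    Primrec fun a => ((l a).map (f a)).sum := by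
  have hstep : Primrec fun q : α × ℕ × ℕ => q.2.1 + q.2.2 := by fun_prop
  exact (Primrec.list_foldr (Primrec.list_map hl hf) (Primrec.const 0) hstep.to₂).of_eq
    fun a => List.sum_eq_foldr.symm

theorem primrec_prod_map {α β : Type*} [Primcodable α] [Primcodable β] {l : α → List β}
    {f : α → β → ℕ} (hl : Primrec l) (hf : Primrec₂ f) :
    Primrec fun a => ((l a).map (f a)).prod := by
  have hstep : Primrec fun q : α × ℕ × ℕ => q.2.1 * q.2.2 := by fun_prop
  exact (Primrec.list_foldr (Primrec.list_map hl hf) (Primrec.const 1) hstep.to₂).of_eq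
    fun a => List.prod_eq_foldr.symm

theorem primrec_words : Primrec words := by
  have hcons (d : Bool) : Primrec fun q : ℕ × List (List Bool) => q.2.map (d :: ·) :=
    Primrec.list_map Primrec.snd (Primrec.list_cons.comp (Primrec.const d) Primrec.snd).to₂
  refine (Primrec.nat_rec₁ [[]] (Primrec.list_append.comp (hcons true) (hcons false)).to₂).of_eq
    fun s => ?_
  induction s with
  | zero => rfl
  | succ s ih => simp only [words, ← ih]

theorem primrecRel_isPrefix : PrimrecRel fun x y : List Bool => x <+: y :=
  (Primrec.eq.comp Primrec.fst (Primrec.list_take.comp (Primrec.list_length.comp Primrec.fst)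
    Primrec.snd)).of_eq fun _ => List.prefix_iff_eq_take.symm

/-- A piece `(r, x, J)` stands for the function on `Ω × [0,1]` that takes the value `r` on
`xΩ × J` and `0` elsewhere; tests are assembled as suprema of pieces. -/
abbrev Piece : Type := ℕ × List Bool × RatCode × RatCode

/-- The largest value on `yΩ` of the pieces from `L` that satisfy `q`. -/
def maxValue (q : Piece → Prop) [DecidablePred q] (L : List Piece) (y : List Bool) : ℕ :=
  L.foldr (fun e v => if q e ∧ e.2.1 <+: y then max e.1 v else v) 0

theorem maxValue_le_iff {q : Piece → Prop} [DecidablePred q] {L : List Piece} {y : List Bool}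
    {v : ℕ} : maxValue q L y ≤ v ↔ ∀ e ∈ L, q e → e.2.1 <+: y → e.1 ≤ v := by
  unfold maxValue
  induction L with
  | nil => simp
  | cons e L ih =>
    simp only [List.foldr_cons, List.mem_cons, forall_eq_or_imp, ← ih]
    split_ifs <;> grind

theorem le_maxValue {q : Piece → Prop} [DecidablePred q] {L : List Piece} {y : List Bool}
    {e : Piece} (he : e ∈ L) (hq : q e) (hy : e.2.1 <+: y) : e.1 ≤ maxValue q L y :=
  maxValue_le_iff.1 le_rfl e he hq hy

theorem maxValue_mono {q q' : Piece → Prop} [DecidablePred q] [DecidablePred q'] {L : List Piece}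
    {y : List Bool} (h : ∀ e ∈ L, q e → q' e) : maxValue q L y ≤ maxValue q' L y :=
  maxValue_le_iff.2 fun e he hq hy => le_maxValue he (h e he hq) hy

/-- The largest value of `2 ^ m * digitProb p b` for `p` in the cell `d = (m, j)`, provided that
`j ≤ 2 ^ m + 1` (the subtraction truncates otherwise); all cells that meet `[0,1]` are such. -/
def digitWeight (d : ℕ × ℕ) (b : Bool) : ℕ := if b then d.2 + 1 else 2 ^ d.1 + 1 - d.2

/-- An upper bound of `2 ^ (m * |y|) * B_p(yΩ)` for `p ∈ [0,1]` in the cell `d = (m, j)`. -/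
def wordWeight (d : ℕ × ℕ) (y : List Bool) : ℕ := (y.map (digitWeight d)).prod

theorem cast_digitWeight {p : I} {d : ℕ × ℕ} (hp : (p : ℝ) ∈ closedInterval (cell d)) (b : Bool) :
    (digitWeight d b : ℝ) = if b then (d.2 : ℝ) + 1 else 2 ^ d.1 + 1 - d.2 := by
  have hleft : (d.2 - 1 : ℝ) / 2 ^ d.1 ≤ 1 := by
    rw [← coe_ratOf_cell_fst]
    exact hp.1.trans p.2.2
  have hj : d.2 ≤ 2 ^ d.1 + 1 := by
    rw [div_le_one (by positivity), sub_le_iff_le_add] at hleft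
    exact_mod_cast hleft
  cases b <;> simp [digitWeight, Nat.cast_sub hj]

theorem mul_two_pow_mem_Icc {p : ℝ} {d : ℕ × ℕ} (hp : p ∈ closedInterval (cell d)) :
    p * 2 ^ d.1 ∈ Set.Icc (d.2 - 1 : ℝ) (d.2 + 1) := by
  obtain ⟨hleft, hright⟩ := hp
  rw [coe_ratOf_cell_fst, div_le_iff₀ (by positivity)] at hleft
  rw [coe_ratOf_cell_snd, le_div_iff₀ (by positivity)] at hright
  exact ⟨hleft, hright⟩

theorem two_pow_mul_digitProb_le {p : I} {d : ℕ × ℕ} (hp : (p : ℝ) ∈ closedInterval (cell d))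
    (b : Bool) : 2 ^ d.1 * digitProb p b ≤ digitWeight d b := by
  have hmem := mul_two_pow_mem_Icc hp
  rw [cast_digitWeight hp, digitProb]
  split_ifs <;> linarith [hmem.1, hmem.2]

theorem digitWeight_le {p : I} {d : ℕ × ℕ} (hp : (p : ℝ) ∈ closedInterval (cell d)) (b : Bool) :
    (digitWeight d b : ℝ) ≤ 2 ^ d.1 * (digitProb p b + 2 * (2 ^ d.1)⁻¹) := by
  have hmem := mul_two_pow_mem_Icc hp
  have hwidth : (2 : ℝ) ^ d.1 * (2 * (2 ^ d.1)⁻¹) = 2 := by field_simp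
  rw [cast_digitWeight hp, digitProb, mul_add, hwidth]
  split_ifs <;> linarith [hmem.1, hmem.2]

theorem pow_length_mul_prod_map (c : ℝ) (f : Bool → ℝ) (y : List Bool) :
    c ^ y.length * (y.map f).prod = (y.map fun b => c * f b).prod := by
  simp [List.prod_map_mul]

theorem cast_wordWeight (d : ℕ × ℕ) (y : List Bool) :
    (wordWeight d y : ℝ) = (y.map fun b => (digitWeight d b : ℝ)).prod := by
  simp [wordWeight, Nat.cast_list_prod, Function.comp_def]

theorem two_pow_mul_wordProb_le {p : I} {d : ℕ × ℕ} (hp : (p : ℝ) ∈ closedInterval (cell d))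
    (y : List Bool) : (2 ^ d.1) ^ y.length * wordProb p y ≤ wordWeight d y := by
  rw [wordProb, pow_length_mul_prod_map, cast_wordWeight]
  exact List.prod_map_le_prod_map₀ _ _
    (fun b _ => mul_nonneg (by positivity) (digitProb_nonneg p b))
    fun b _ => two_pow_mul_digitProb_le hp b

theorem wordWeight_le {p : I} {d : ℕ × ℕ} (hp : (p : ℝ) ∈ closedInterval (cell d))
    (y : List Bool) : (wordWeight d y : ℝ) ≤
      (2 ^ d.1) ^ y.length * (y.map fun b => digitProb p b + 2 * (2 ^ d.1)⁻¹).prod := by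
  rw [pow_length_mul_prod_map, cast_wordWeight]
  exact List.prod_map_le_prod_map₀ _ _ (fun b _ => Nat.cast_nonneg _)
    fun b _ => digitWeight_le hp b

/-- A decidable condition under which, for all `p` in the cell `d`, the maximum of those pieces
from `L` that are active at `p` has `B_p`-integral at most `2`. The words in `L` need not be
shorter than `s`, but longer ones are ignored. -/
def Bounded (L : List Piece) (s : ℕ) (d : ℕ × ℕ) : Prop :=
  ((words s).map fun y => wordWeight d y * maxValue (fun e => Meets (cell d) e.2.2) L y).sum ≤
    2 * (2 ^ d.1) ^ s

theorem Bounded.lintegral_le {L : List Piece} {s : ℕ} {d : ℕ × ℕ} (h : Bounded L s d) {p : I}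
    (hp : (p : ℝ) ∈ closedInterval (cell d)) {q : Piece → Prop} [DecidablePred q]
    (hq : ∀ e ∈ L, q e → (p : ℝ) ∈ closedInterval e.2.2) :
    ∫⁻ ω, (maxValue q L (digitPrefix ω s) : ℝ≥0∞) ∂(bernoulliProd p) ≤ 2 := by
  rw [lintegral_comp_digitPrefix, ← ENNReal.ofReal_ofNat]
  refine ENNReal.ofReal_le_ofReal (le_of_mul_le_mul_left ?_ (by positivity : 0 < (2 ^ d.1 : ℝ) ^ s))
  calc (2 ^ d.1 : ℝ) ^ s * ((words s).map fun y => wordProb p y * maxValue q L y).sum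
      ≤ ((words s).map fun y => (wordWeight d y : ℝ) *
          maxValue (fun e => Meets (cell d) e.2.2) L y).sum := by
        rw [← List.sum_map_mul_left]
        refine List.sum_le_sum fun y hy => ?_
        rw [← mul_assoc, ← mem_words_iff.1 hy]
        refine mul_le_mul (two_pow_mul_wordProb_le hp y) ?_ (by positivity) (by positivity)
        exact_mod_cast maxValue_mono fun e he hqe => meets_of_mem hp (hq e he hqe)
    _ ≤ (2 ^ d.1 : ℝ) ^ s * 2 := by
        rw [mul_comm _ (2 : ℝ)]
        simpa [Bounded, ← @Nat.cast_le ℝ, Nat.cast_list_sum, Function.comp_def] using h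

theorem eventually_sum_wordWeight_lt {p : I} {s : ℕ} {v : List Bool → ℕ} {c : ℝ}
    (h : ((words s).map fun y => wordProb p y * v y).sum < c) :
    ∀ᶠ m in atTop, ∀ j, (p : ℝ) ∈ closedInterval (cell (m, j)) →
      ((words s).map fun y => (wordWeight (m, j) y : ℝ) * v y).sum < c * (2 ^ m) ^ s := by
  let blurred : ℝ → ℝ := fun ε =>
    ((words s).map fun y => (y.map fun b => digitProb p b + ε).prod * v y).sum
  have hcont : Continuous blurred :=
    continuous_list_sum _ fun y _ => (continuous_list_prod _ fun b _ =>
      continuous_const.add continuous_id).mul continuous_const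
  have hlt : ∀ᶠ ε in nhds 0, blurred ε < c :=
    (hcont.tendsto 0).eventually_lt_const (by simpa [blurred, wordProb] using h)
  filter_upwards [tendsto_two_mul_inv_two_pow.eventually hlt] with m hm j hp
  calc ((words s).map fun y => (wordWeight (m, j) y : ℝ) * v y).sum
      ≤ (2 ^ m) ^ s * blurred (2 * (2 ^ m)⁻¹) := by
        rw [← List.sum_map_mul_left]
        refine List.sum_le_sum fun y hy => ?_
        rw [← mul_assoc, ← mem_words_iff.1 hy]
        exact mul_le_mul_of_nonneg_right (wordWeight_le hp y) (Nat.cast_nonneg _)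
    _ < c * (2 ^ m) ^ s := by
        rw [mul_comm]
        exact mul_lt_mul_of_pos_right hm (by positivity)

theorem eventually_bounded {L : List Piece} {s : ℕ} {p : I} {q : Piece → Prop} [DecidablePred q]
    (hq : ∀ e ∈ L, (p : ℝ) ∈ closedInterval e.2.2 → q e)
    (h : ∫⁻ ω, (maxValue q L (digitPrefix ω s) : ℝ≥0∞) ∂(bernoulliProd p) ≤ 1) :
    ∀ᶠ m in atTop, ∀ j, (p : ℝ) ∈ closedInterval (cell (m, j)) → Bounded L s (m, j) := by
  rw [lintegral_comp_digitPrefix, ENNReal.ofReal_le_one] at h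
  have hmeets : ∀ᶠ m in atTop, ∀ e ∈ L.toFinset, ∀ j,
      (p : ℝ) ∈ closedInterval (cell (m, j)) → Meets (cell (m, j)) e.2.2 → q e := by
    refine (eventually_all_finset _).2 fun e he => ?_
    by_cases hpe : (p : ℝ) ∈ closedInterval e.2.2
    · exact .of_forall fun _ _ _ _ => hq e (List.mem_toFinset.1 he) hpe
    · filter_upwards [eventually_not_meets_cell hpe] with m hm j hp hmeets
      exact absurd hmeets (hm j hp)
  filter_upwards [eventually_sum_wordWeight_lt (h.trans_lt one_lt_two), hmeets]
    with m hsum hmeets j hp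
  refine le_trans (List.sum_le_sum fun y _ => Nat.mul_le_mul_left _ (maxValue_mono fun e he =>
    hmeets e (List.mem_toFinset.2 he) j hp)) ?_
  simpa [← @Nat.cast_le ℝ, Nat.cast_list_sum, Function.comp_def] using (hsum j hp).le

theorem primrec_wordWeight : Primrec₂ wordWeight := by
  have hdigit : Primrec₂ digitWeight :=
    Primrec.ite (Primrec.eq.comp Primrec.snd (Primrec.const true)) (by fun_prop) (by fun_prop)
  have hfst : Primrec fun q : ((ℕ × ℕ) × List Bool) × Bool => q.1.1 := by fun_prop
  exact primrec_prod_map Primrec.snd (hdigit.comp hfst Primrec.snd).to₂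

theorem primrec_maxValue_meets :
    Primrec fun q : (ℕ × ℕ) × List Piece × List Bool =>
      maxValue (fun e => Meets (cell q.1) e.2.2) q.2.1 q.2.2 := by
  have hmeets : PrimrecPred fun q : ((ℕ × ℕ) × List Piece × List Bool) × Piece × ℕ =>
      Meets (cell q.1.1) q.2.1.2.2 :=
    primrecRel_meets.comp (by fun_prop) (by fun_prop)
  have hprefix : PrimrecPred fun q : ((ℕ × ℕ) × List Piece × List Bool) × Piece × ℕ =>
      q.2.1.2.1 <+: q.1.2.2 :=
    primrecRel_isPrefix.comp (by fun_prop) (by fun_prop)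
  have hmax : Primrec fun q : ((ℕ × ℕ) × List Piece × List Bool) × Piece × ℕ =>
      max q.2.1.1 q.2.2 :=
    Primrec.nat_max.comp (by fun_prop) (by fun_prop)
  exact Primrec.list_foldr (Primrec.fst.comp Primrec.snd) (Primrec.const 0)
    (Primrec.ite (hmeets.and hprefix) hmax (Primrec.snd.comp Primrec.snd)).to₂

theorem primrecPred_bounded :
    PrimrecPred fun q : (List Piece × ℕ) × ℕ × ℕ => Bounded q.1.1 q.1.2 q.2 := by
  have hargs : Primrec fun q : ((List Piece × ℕ) × ℕ × ℕ) × List Bool =>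
      (q.1.2, q.1.1.1, q.2) := by fun_prop
  have hmax : Primrec fun q : ((List Piece × ℕ) × ℕ × ℕ) × List Bool =>
      maxValue (fun e => Meets (cell q.1.2) e.2.2) q.1.1.1 q.2 := by
    have h := primrec_maxValue_meets.comp hargs
    beta_reduce at h
    exact h
  have hterm : Primrec fun q : ((List Piece × ℕ) × ℕ × ℕ) × List Bool =>
      wordWeight q.1.2 q.2 * maxValue (fun e => Meets (cell q.1.2) e.2.2) q.1.1.1 q.2 :=
    primrec_mul (primrec_wordWeight.comp (Primrec.snd.comp Primrec.fst) Primrec.snd) hmax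
  have hbound : Primrec fun q : (List Piece × ℕ) × ℕ × ℕ => 2 * (2 ^ q.2.1) ^ q.1.2 := by
    fun_prop
  unfold Bounded
  exact Primrec.nat_le.comp
    (primrec_sum_map (primrec_words.comp (Primrec.snd.comp Primrec.fst)) hterm.to₂) hbound

/-! ### Suprema of enumerated steps -/

section StepSup

variable {α X : Type}

/-- The supremum of the functions `a / 2 ^ m` on `base b`, `0` elsewhere, over the steps
`((a, m), b)` that satisfy `V`. -/
noncomputable def stepSup (base : α → Set X) (V : (ℕ × ℕ) × α → Prop) (x : X) : ℝ≥0∞ :=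
  ⨆ (w : (ℕ × ℕ) × α) (_ : V w ∧ x ∈ base w.2), (w.1.1 : ℝ≥0∞) * 2⁻¹ ^ w.1.2

variable {base : α → Set X} {V : (ℕ × ℕ) × α → Prop}

theorem le_stepSup {a m : ℕ} {b : α} (hV : V ((a, m), b)) {x : X} (hx : x ∈ base b) :
    (a : ℝ≥0∞) * 2⁻¹ ^ m ≤ stepSup base V x :=
  le_iSup₂_of_le ((a, m), b) ⟨hV, hx⟩ le_rfl

theorem stepSup_le {x : X} {v : ℝ≥0∞}
    (h : ∀ a m b, V ((a, m), b) → x ∈ base b → (a : ℝ≥0∞) * 2⁻¹ ^ m ≤ v) :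
    stepSup base V x ≤ v :=
  iSup₂_le fun w hw => h w.1.1 w.1.2 w.2 hw.1 hw.2

theorem ratOf_lt_stepSup_iff {x : X} (hx : ∃ w, V w ∧ x ∈ base w.2) {r : RatCode} :
    ((ratOf r : ℝ) : EReal) < (stepSup base V x : EReal) ↔
      ∃ w, (V w ∧ x ∈ base w.2) ∧ ratOf r < ratOf (dyadicCode w.1.1 w.1.2) := by
  simp only [← ratOf_lt_natCast_mul_iff, lt_coe_ennreal_iff, stepSup, lt_iSup_iff, exists_prop]
  constructor
  · rintro (hneg | ⟨w, hw, hlt⟩)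
    · exact hx.imp fun w hw => ⟨hw, .inl hneg⟩
    · exact ⟨w, hw, .inr hlt⟩
  · rintro ⟨w, hw, hneg | hlt⟩
    · exact .inl hneg
    · exact .inr ⟨w, hw, hlt⟩

theorem lowerSemicomputable_stepSup [Primcodable α] {O : Set (ℕ →. ℕ)}
    (hV : REPredIn O fun q : RatCode × α =>
      ∃ d : ℕ × ℕ, V (d, q.2) ∧ ratOf q.1 < ratOf (dyadicCode d.1 d.2))
    (hcover : ∀ x, ∃ w, V w ∧ x ∈ base w.2) : LowerSemicomputable O base (stepSup base V) := by
  refine ⟨_, hV, fun r => Set.ext fun x => (ratOf_lt_stepSup_iff (hcover x)).trans ?_⟩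
  constructor
  · rintro ⟨⟨d, a⟩, ⟨hw, hx⟩, hlt⟩
    exact ⟨a, ⟨d, hw, hlt⟩, hx⟩
  · rintro ⟨a, ⟨d, hw, hlt⟩, hx⟩
    exact ⟨(d, a), ⟨hw, hx⟩, hlt⟩

end StepSup

/-! ### The universal uniform test -/

/-- The pieces with words of length at most `s` that the `c`-th program accepts within `s` steps. -/
def stage (c s : ℕ) : List Piece :=
  (List.range s).filterMap fun i => (decode (α := Piece) i).bind fun e =>
    if (Code.evaln s (Denumerable.ofNat Code c) (encode e)).isSome = true ∧ e.2.1.length ≤ s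
    then some e else none

theorem mem_stage_iff {c s : ℕ} {e : Piece} : e ∈ stage c s ↔
    (Code.evaln s (Denumerable.ofNat Code c) (encode e)).isSome = true ∧ e.2.1.length ≤ s := by
  simp only [stage, List.mem_filterMap, List.mem_range, Option.bind_eq_some_iff]
  constructor
  · rintro ⟨i, -, e', -, h⟩
    split_ifs at h with haccept
    obtain rfl : e' = e := by simpa using h
    exact haccept
  · intro h
    obtain ⟨y, hy⟩ := Option.isSome_iff_exists.1 h.1
    exact ⟨encode e, Code.evaln_bound hy, e, encodek e, if_pos h⟩

theorem stage_mono {c s t : ℕ} (h : s ≤ t) {e : Piece} (he : e ∈ stage c s) : e ∈ stage c t := by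
  rw [mem_stage_iff] at he ⊢
  obtain ⟨y, hy⟩ := Option.isSome_iff_exists.1 he.1
  exact ⟨Option.isSome_iff_exists.2 ⟨y, Code.evaln_mono h hy⟩, he.2.trans h⟩

theorem primrec_stage : Primrec₂ stage := by
  have hinput : Primrec fun q : ((ℕ × ℕ) × ℕ) × Piece =>
      ((q.1.1.2, Denumerable.ofNat Code q.1.1.1), encode q.2) :=
    (Primrec.pair (by fun_prop) ((Primrec.ofNat Code).comp (by fun_prop))).pair (by fun_prop)
  have haccept : PrimrecPred fun q : ((ℕ × ℕ) × ℕ) × Piece =>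
      (Code.evaln q.1.1.2 (Denumerable.ofNat Code q.1.1.1) (encode q.2)).isSome = true :=
    Primrec.eq.comp (Primrec.option_isSome.comp (Code.primrec_evaln.comp hinput))
      (Primrec.const true)
  have hlength : PrimrecPred fun q : ((ℕ × ℕ) × ℕ) × Piece => q.2.2.1.length ≤ q.1.1.2 :=
    Primrec.nat_le.comp (Primrec.list_length.comp (by fun_prop)) (by fun_prop)
  exact Primrec.listFilterMap (Primrec.list_range.comp Primrec.snd)
    (Primrec.option_bind (Primrec.decode.comp Primrec.snd) (Primrec.ite (haccept.and hlength)
      (Primrec.option_some.comp Primrec.snd) (Primrec.const none)).to₂).to₂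

theorem exists_stage_of_rePred {S : Piece → Prop} (hS : REPred S) :
    ∃ c, ∀ e, S e ↔ ∃ s, e ∈ stage c s := by
  obtain ⟨C, hC⟩ := exists_code_of_rePred hS
  refine ⟨encode C, fun e => (hC e).trans ?_⟩
  simp only [mem_stage_iff, Denumerable.ofNat_encode]
  constructor
  · rintro ⟨s, hs⟩
    obtain ⟨y, hy⟩ := Option.isSome_iff_exists.1 hs
    exact ⟨max s e.2.1.length, Option.isSome_iff_exists.2
      ⟨y, Code.evaln_mono (le_max_left _ _) hy⟩, le_max_right _ _⟩
  · rintro ⟨s, hs, -⟩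
    exact ⟨s, hs⟩

/-- The piece `e` of the `s`-th stage of the `c`-th program may be used on the cell `d`: the whole
stage has bounded integrals there, and the cell lies inside the parameter interval of `e`. -/
def Admissible (c s : ℕ) (e : Piece) (d : ℕ × ℕ) : Prop :=
  (e ∈ stage c s ∧ Bounded (stage c s) s d) ∧ Inside (cell d) e.2.2

theorem primrecPred_admissible :
    PrimrecPred fun q : ((ℕ × ℕ) × Piece) × ℕ × ℕ => Admissible q.1.1.1 q.1.1.2 q.1.2 q.2 := by
  have hstage : Primrec fun q : ((ℕ × ℕ) × Piece) × ℕ × ℕ => stage q.1.1.1 q.1.1.2 :=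
    primrec_stage.comp (by fun_prop) (by fun_prop)
  have hmem : PrimrecPred fun q : ((ℕ × ℕ) × Piece) × ℕ × ℕ => q.1.2 ∈ stage q.1.1.1 q.1.1.2 :=
    (Primrec.eq.exists_mem_list.comp hstage (Primrec.snd.comp Primrec.fst)).of_eq fun q => by simp
  have hbounded : PrimrecPred fun q : ((ℕ × ℕ) × Piece) × ℕ × ℕ =>
      Bounded (stage q.1.1.1 q.1.1.2) q.1.1.2 q.2 :=
    primrecPred_bounded.comp (f := fun q : ((ℕ × ℕ) × Piece) × ℕ × ℕ =>
      ((stage q.1.1.1 q.1.1.2, q.1.1.2), q.2)) ((hstage.pair (by fun_prop)).pair Primrec.snd)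
  have hinside : PrimrecPred fun q : ((ℕ × ℕ) × Piece) × ℕ × ℕ => Inside (cell q.2) q.1.2.2.2 :=
    primrecRel_inside.comp (by fun_prop) (by fun_prop)
  exact (hmem.and hbounded).and hinside

/-- The steps of the universal test: the constant `1 / 2`, and the admissible pieces of the `c`-th
program with weight `1 / 2 ^ (c + 3)`. -/
def universalStep (w : (ℕ × ℕ) × List Bool × RatCode × RatCode) : Prop :=
  w = ((1, 1), ([], (0, 1, 0), (2, 0, 0))) ∨
    ∃ c s e d, Admissible c s e d ∧ w = ((e.1, c + 3), (e.2.1, cell d))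

/-- A universal uniform Bernoulli test. -/
noncomputable def universalTest : Omega × I → ℝ≥0∞ := stepSup rectangle universalStep

theorem mem_rectangle_univ (z : Omega × I) : z ∈ rectangle ([], (0, 1, 0), (2, 0, 0)) := by
  have hp := z.2.2
  refine ⟨fun i => i.elim0, ?_, ?_⟩ <;> norm_num [ratOf] <;> linarith [hp.1, hp.2]

theorem inv_two_le_universalTest (z : Omega × I) : 2⁻¹ ≤ universalTest z := by
  simpa [universalTest] using le_stepSup (V := universalStep) (.inl rfl) (mem_rectangle_univ z)

theorem Admissible.le_universalTest {c s : ℕ} {e : Piece} {d : ℕ × ℕ} (h : Admissible c s e d)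
    {ω : Omega} (hω : ω ∈ wordCylinder e.2.1) {p : I} (hp : (p : ℝ) ∈ openInterval (cell d)) :
    (e.1 : ℝ≥0∞) ≤ 2 ^ (c + 3) * universalTest (ω, p) := by
  have hstep : (e.1 : ℝ≥0∞) * 2⁻¹ ^ (c + 3) ≤ universalTest (ω, p) :=
    le_stepSup (b := (e.2.1, cell d)) (.inr ⟨c, s, e, d, h, rfl⟩) ⟨hω, hp⟩
  calc (e.1 : ℝ≥0∞) = 2 ^ (c + 3) * (e.1 * 2⁻¹ ^ (c + 3)) := by
        rw [mul_left_comm, ← mul_pow, ENNReal.mul_inv_cancel two_ne_zero ENNReal.ofNat_ne_top,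
          one_pow, mul_one]
    _ ≤ 2 ^ (c + 3) * universalTest (ω, p) := by gcongr

theorem rePred_universalStep : REPred universalStep := by
  have hconst : REPred fun w : (ℕ × ℕ) × List Bool × RatCode × RatCode =>
      w = ((1, 1), ([], (0, 1, 0), (2, 0, 0))) :=
    (Primrec.eq.comp Primrec.id (Primrec.const _)).computablePred.to_re
  have hadm : PrimrecPred fun q : (((((ℕ × ℕ) × List Bool × RatCode × RatCode) × ℕ) × ℕ) × Piece)
      × ℕ × ℕ => Admissible q.1.1.1.2 q.1.1.2 q.1.2 q.2 :=
    primrecPred_admissible.comp (f := fun q : (((((ℕ × ℕ) × List Bool × RatCode × RatCode) × ℕ) ×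
      ℕ) × Piece) × ℕ × ℕ => (((q.1.1.1.2, q.1.1.2), q.1.2), q.2)) (by fun_prop)
  have heq : PrimrecPred fun q : (((((ℕ × ℕ) × List Bool × RatCode × RatCode) × ℕ) × ℕ) × Piece)
      × ℕ × ℕ => q.1.1.1.1 = ((q.1.2.1, q.1.1.1.2 + 3), (q.1.2.2.1, cell q.2)) :=
    Primrec.eq.comp (by fun_prop) (by fun_prop)
  exact rePred_or hconst (rePred_exists (rePred_exists (rePred_exists (rePred_exists
    (hadm.and heq).computablePred.to_re))))

theorem lowerSemicomputable_universalTest : LowerSemicomputable ∅ rectangle universalTest := by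
  have hstep : Primrec fun q : (RatCode × List Bool × RatCode × RatCode) × ℕ × ℕ =>
      (q.2, q.1.2) := by fun_prop
  have hlt : PrimrecPred fun q : (RatCode × List Bool × RatCode × RatCode) × ℕ × ℕ =>
      ratOf q.1.1 < ratOf (dyadicCode q.2.1 q.2.2) :=
    primrecRel_ratOf_lt.comp (by fun_prop) (by fun_prop)
  refine lowerSemicomputable_stepSup (rePredIn_empty.2 (rePred_exists (rePred_and
    (rePred_comp rePred_universalStep hstep.to_comp) hlt.computablePred.to_re))) fun z => ?_
  exact ⟨_, .inl rfl, mem_rectangle_univ z⟩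

open Classical in
/-- The supremum at `p` of the pieces of the `s`-th stage of the `c`-th program. -/
noncomputable def stageValue (p : I) (c s : ℕ) (ω : Omega) : ℝ≥0∞ :=
  (maxValue (fun e => (p : ℝ) ∈ closedInterval e.2.2) (stage c s) (digitPrefix ω s) : ℝ≥0∞)

theorem measurable_stageValue (p : I) (c s : ℕ) : Measurable (stageValue p c s) := by
  classical
  exact measurable_comp_digitPrefix (fun y =>
    (maxValue (fun e => (p : ℝ) ∈ closedInterval e.2.2) (stage c s) y : ℝ≥0∞)) s

theorem le_stageValue {p : I} {c s : ℕ} {e : Piece} {ω : Omega} (he : e ∈ stage c s)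
    (hp : (p : ℝ) ∈ closedInterval e.2.2) (hω : ω ∈ wordCylinder e.2.1) :
    (e.1 : ℝ≥0∞) ≤ stageValue p c s ω := by
  classical
  exact Nat.cast_le.2 (le_maxValue he hp
    (isPrefix_digitPrefix_iff.2 ⟨(mem_stage_iff.1 he).2, hω⟩))

theorem stageValue_le {p : I} {c s : ℕ} {ω : Omega} {v : ℝ≥0∞} (h : ∀ e ∈ stage c s,
    (p : ℝ) ∈ closedInterval e.2.2 → ω ∈ wordCylinder e.2.1 → (e.1 : ℝ≥0∞) ≤ v) :
    stageValue p c s ω ≤ v := by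
  classical
  rcases eq_or_ne v ∞ with rfl | hv
  · exact le_top
  · lift v to ℝ≥0 using hv
    rw [stageValue, ← ENNReal.coe_natCast, ENNReal.coe_le_coe, ← Nat.le_floor_iff zero_le,
      maxValue_le_iff]
    intro e he hp hy
    rw [Nat.le_floor_iff zero_le]
    exact_mod_cast h e he hp (isPrefix_digitPrefix_iff.1 hy).2

theorem monotone_stageValue (p : I) (c : ℕ) : Monotone (stageValue p c) := fun _ _ hst _ =>
  stageValue_le fun _ he hp hω => le_stageValue (stage_mono hst he) hp hω

/-- The stages of the `c`-th program that are bounded on some cell around `p`. -/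
def boundedStages (p : I) (c : ℕ) : Set ℕ :=
  {s | ∃ d, (p : ℝ) ∈ openInterval (cell d) ∧ Bounded (stage c s) s d}

/-- The part of the universal test at `p` that comes from the `c`-th program, without its weight. -/
noncomputable def programTest (p : I) (c : ℕ) (ω : Omega) : ℝ≥0∞ :=
  ⨆ s : boundedStages p c, stageValue p c s ω

theorem measurable_programTest (p : I) (c : ℕ) : Measurable (programTest p c) :=
  Measurable.iSup fun s => measurable_stageValue p c s

theorem lintegral_programTest_le (p : I) (c : ℕ) :
    ∫⁻ ω, programTest p c ω ∂(bernoulliProd p) ≤ 2 := by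
  classical
  unfold programTest
  rw [lintegral_iSup_directed fun s : boundedStages p c =>
    (measurable_stageValue p c s).aemeasurable]
  · exact iSup_le fun ⟨s, d, hp, hbounded⟩ =>
      hbounded.lintegral_le (openInterval_subset_closedInterval _ hp) fun _ _ hpe => hpe
  · exact directed_of_isDirected_le fun s t hst => monotone_stageValue p c hst

theorem universalTest_le_tsum (p : I) (ω : Omega) :
    universalTest (ω, p) ≤ 2⁻¹ + ∑' c, 2⁻¹ ^ (c + 3) * programTest p c ω := by
  refine stepSup_le fun a m b hw hmem => ?_
  rcases hw with hw | ⟨c, s, e, d, hadm, hw⟩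
  · obtain ⟨⟨rfl, rfl⟩, -⟩ : (a = 1 ∧ m = 1) ∧ _ := by simpa only [Prod.mk.injEq] using hw
    simp
  · obtain ⟨⟨rfl, rfl⟩, rfl⟩ : (a = e.1 ∧ m = c + 3) ∧ b = (e.2.1, cell d) := by
      simpa only [Prod.mk.injEq] using hw
    have hp : (p : ℝ) ∈ openInterval (cell d) := hmem.2
    have hpe : (p : ℝ) ∈ openInterval e.2.2 :=
      hadm.2.closedInterval_subset (openInterval_subset_closedInterval _ hp)
    have hle : (e.1 : ℝ≥0∞) ≤ programTest p c ω :=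
      (le_stageValue hadm.1.1 (openInterval_subset_closedInterval _ hpe) hmem.1).trans
        (le_iSup_of_le ⟨s, d, hp, hadm.1.2⟩ le_rfl)
    calc (e.1 : ℝ≥0∞) * 2⁻¹ ^ (c + 3) ≤ 2⁻¹ ^ (c + 3) * programTest p c ω := by
          rw [mul_comm]
          gcongr
      _ ≤ ∑' c, 2⁻¹ ^ (c + 3) * programTest p c ω :=
          ENNReal.le_tsum (f := fun c => 2⁻¹ ^ (c + 3) * programTest p c ω) c
      _ ≤ _ := le_add_self

theorem tsum_inv_two_pow_add_three_mul_two : ∑' c : ℕ, (2⁻¹ : ℝ≥0∞) ^ (c + 3) * 2 = 2⁻¹ := by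
  have hcancel : (2⁻¹ : ℝ≥0∞) * 2 = 1 := ENNReal.inv_mul_cancel two_ne_zero ENNReal.ofNat_ne_top
  calc ∑' c : ℕ, (2⁻¹ : ℝ≥0∞) ^ (c + 3) * 2 = ∑' c : ℕ, (2⁻¹ : ℝ≥0∞) ^ (c + 1) * 2⁻¹ := by
        congr with c
        rw [pow_add, pow_add, pow_one, pow_succ 2⁻¹ 2, mul_assoc, mul_assoc, hcancel, mul_one,
          pow_two, mul_assoc]
    _ = 2⁻¹ := by
        rw [ENNReal.tsum_mul_right, ENNReal.tsum_geometric_add_one, ENNReal.one_sub_inv_two,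
          inv_inv, hcancel, one_mul]

theorem lintegral_universalTest_le (p : I) :
    ∫⁻ ω, universalTest (ω, p) ∂(bernoulliProd p) ≤ 1 := by
  calc ∫⁻ ω, universalTest (ω, p) ∂(bernoulliProd p)
      ≤ ∫⁻ ω, (2⁻¹ + ∑' c, 2⁻¹ ^ (c + 3) * programTest p c ω) ∂(bernoulliProd p) :=
        lintegral_mono (universalTest_le_tsum p)
    _ = 2⁻¹ + ∑' c, 2⁻¹ ^ (c + 3) * ∫⁻ ω, programTest p c ω ∂(bernoulliProd p) := by
        rw [lintegral_add_left measurable_const, lintegral_const, measure_univ, mul_one,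
          lintegral_tsum fun c => ((measurable_programTest p c).const_mul _).aemeasurable]
        simp only [lintegral_const_mul _ (measurable_programTest p _)]
    _ ≤ 2⁻¹ + ∑' c : ℕ, 2⁻¹ ^ (c + 3) * 2 := by
        gcongr with c
        exact lintegral_programTest_le p c
    _ = 1 := by rw [tsum_inv_two_pow_add_three_mul_two, ENNReal.inv_two_add_inv_two]

theorem isUniformBernoulliTest_universalTest : IsUniformBernoulliTest universalTest :=
  ⟨lowerSemicomputable_universalTest, lintegral_universalTest_le⟩

/-! ### Universality of the uniform test -/

theorem DominatedBy.trans {X : Type} {f g h : X → ℝ≥0∞} (hfg : DominatedBy f g)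
    (hgh : DominatedBy g h) : DominatedBy f h := by
  obtain ⟨c, hc⟩ := hfg
  obtain ⟨d, hd⟩ := hgh
  refine ⟨c * d, fun x => ?_⟩
  calc f x ≤ c * g x := hc x
    _ ≤ c * (d * h x) := by gcongr; exact hd x
    _ = ((c * d : ℝ≥0) : ℝ≥0∞) * h x := by rw [ENNReal.coe_mul, mul_assoc]

theorem DominatedBy.lt_top {X : Type} {f g : X → ℝ≥0∞} (h : DominatedBy f g) {x : X}
    (hx : g x < ∞) : f x < ∞ := by
  obtain ⟨c, hc⟩ := h
  exact (hc x).trans_lt (ENNReal.mul_lt_top ENNReal.coe_lt_top hx)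

theorem DominatedBy.comp {X Y : Type} {f g : X → ℝ≥0∞} (h : DominatedBy f g) (k : Y → X) :
    DominatedBy (f ∘ k) (g ∘ k) :=
  h.imp fun _ hc y => hc (k y)

theorem IsUniversal.eqUpToConst {X : Type} {P : (X → ℝ≥0∞) → Prop} {u v : X → ℝ≥0∞}
    (hu : IsUniversal P u) (hv : IsUniversal P v) : EqUpToConst u v :=
  ⟨hv.2 u hu.1, hu.2 v hv.1⟩

theorem LowerSemicomputable.exists_natCast_lt_iff {α X : Type} [Primcodable α]
    {O : Set (ℕ →. ℕ)} {base : α → Set X} {t : X → ℝ≥0∞} (ht : LowerSemicomputable O base t) :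
    ∃ W : ℕ × α → Prop, REPredIn O W ∧
      ∀ (r : ℕ) x, (r : ℝ≥0∞) < t x ↔ ∃ a, W (r, a) ∧ x ∈ base a := by
  obtain ⟨W, hW, hWt⟩ := ht
  have hcode : Primrec fun q : ℕ × α => (((q.1, 0, 0), q.2) : RatCode × α) := by fun_prop
  refine ⟨_, hW.comp hcode.to_comp, fun r x => ?_⟩
  have hratOf : ((ratOf (r, 0, 0) : ℚ) : ℝ) = r := by simp [ratOf]
  refine Iff.trans ?_ (Set.ext_iff.1 (hWt (r, 0, 0)) x)
  rw [Set.mem_ofPred_eq, hratOf, lt_coe_ennreal_iff, ENNReal.ofReal_natCast,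
    or_iff_right (not_lt.2 r.cast_nonneg)]

theorem le_add_one_of_forall_natCast {a b : ℝ≥0∞}
    (h : ∀ r : ℕ, (r : ℝ≥0∞) < a → (r : ℝ≥0∞) ≤ b) : a ≤ b + 1 := by
  by_contra! hlt
  lift b to ℝ≥0 using fun hb => by simp [hb] at hlt
  have hceil : ((⌊b⌋₊ + 1 : ℕ) : ℝ≥0∞) ≤ b + 1 := by
    exact_mod_cast add_le_add_left (Nat.floor_le (zero_le : 0 ≤ b)) 1
  have hle : ((⌊b⌋₊ + 1 : ℕ) : ℝ≥0) ≤ b := by exact_mod_cast h _ (hceil.trans_lt hlt)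
  exact absurd (Nat.lt_floor_add_one b) (not_lt.2 (by exact_mod_cast hle))

/-- The pieces in `S` represent the function `g` at the parameter `p`: those whose parameter
interval contains `p` stay below `g`, and they reach every natural number below a value of `g`. -/
structure Represents (S : Piece → Prop) (p : I) (g : Omega → ℝ≥0∞) : Prop where
  le {e : Piece} {ω : Omega} : S e → (p : ℝ) ∈ closedInterval e.2.2 → ω ∈ wordCylinder e.2.1 →
    (e.1 : ℝ≥0∞) ≤ g ω
  exists_piece {r : ℕ} {ω : Omega} : (r : ℝ≥0∞) < g ω →
    ∃ x J, S (r, x, J) ∧ ω ∈ wordCylinder x ∧ (p : ℝ) ∈ openInterval J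

theorem Represents.natCast_le_mul_universalTest {S : Piece → Prop} {p : I} {g : Omega → ℝ≥0∞}
    (hg : Represents S p g) (hint : ∫⁻ ω, g ω ∂(bernoulliProd p) ≤ 1) {c : ℕ}
    (hc : ∀ e, S e ↔ ∃ s, e ∈ stage c s) {r : ℕ} {ω : Omega} (hr : (r : ℝ≥0∞) < g ω) :
    (r : ℝ≥0∞) ≤ 2 ^ (c + 3) * universalTest (ω, p) := by
  classical
  obtain ⟨x, J, hS, hω, hJ⟩ := hg.exists_piece hr
  obtain ⟨s, hs⟩ := (hc _).1 hS
  have hstage : ∫⁻ ω, stageValue p c s ω ∂(bernoulliProd p) ≤ 1 :=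
    (lintegral_mono fun ω => stageValue_le fun e he hp hω =>
      hg.le ((hc e).2 ⟨s, he⟩) hp hω).trans hint
  obtain ⟨m, hbounded, hinside⟩ := ((eventually_bounded (fun _ _ hp => hp) hstage).and
    (eventually_inside_cell hJ)).exists
  obtain ⟨j, hj⟩ := exists_mem_openInterval_cell p.2.1 m
  have hj' := openInterval_subset_closedInterval _ hj
  have hadm : Admissible c s (r, x, J) (m, j) := ⟨⟨hs, hbounded j hj'⟩, hinside j hj'⟩
  exact hadm.le_universalTest hω hj

theorem exists_le_mul_universalTest {S : Piece → Prop} (hS : REPred S) :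
    ∃ C : ℝ≥0, ∀ (p : I) (g : Omega → ℝ≥0∞), Represents S p g →
      ∫⁻ ω, g ω ∂(bernoulliProd p) ≤ 1 → ∀ ω, g ω ≤ C * universalTest (ω, p) := by
  obtain ⟨c, hc⟩ := exists_stage_of_rePred hS
  refine ⟨2 ^ (c + 3) + 2, fun p g hg hint ω => ?_⟩
  calc g ω ≤ 2 ^ (c + 3) * universalTest (ω, p) + 1 := le_add_one_of_forall_natCast fun _ hr =>
        hg.natCast_le_mul_universalTest hint hc hr
    _ = 2 ^ (c + 3) * universalTest (ω, p) + 2 * 2⁻¹ := by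
        rw [ENNReal.mul_inv_cancel two_ne_zero ENNReal.ofNat_ne_top]
    _ ≤ 2 ^ (c + 3) * universalTest (ω, p) + 2 * universalTest (ω, p) := by
        gcongr
        exact inv_two_le_universalTest _
    _ = ((2 ^ (c + 3) + 2 : ℝ≥0) : ℝ≥0∞) * universalTest (ω, p) := by
        push_cast
        rw [add_mul]

theorem IsUniformBernoulliTest.exists_represents {t : Omega × I → ℝ≥0∞}
    (ht : IsUniformBernoulliTest t) :
    ∃ S, REPred S ∧ ∀ p, Represents S p fun ω => t (ω, p) := by
  obtain ⟨W, hW, hWt⟩ := ht.1.exists_natCast_lt_iff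
  have hinput : Primrec fun q : Piece × RatCode × RatCode => (q.1.1, q.1.2.1, q.2) := by fun_prop
  refine ⟨fun e => ∃ J, W (e.1, e.2.1, J) ∧ Inside e.2.2 J, rePred_exists_inside
    (rePred_comp (rePredIn_empty.1 hW) hinput.to_comp) (by fun_prop) Primrec.id,
    fun p => ⟨?_, fun {r ω} hr => ?_⟩⟩
  · rintro e ω ⟨J, hJ, hinside⟩ hp hω
    exact ((hWt _ (ω, p)).2 ⟨_, hJ, hω, hinside.closedInterval_subset hp⟩).le
  · obtain ⟨⟨x, J⟩, hx, hω, hp⟩ := (hWt r (ω, p)).1 hr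
    obtain ⟨m, hm⟩ := (eventually_inside_cell hp).exists
    obtain ⟨j, hj⟩ := exists_mem_openInterval_cell p.2.1 m
    exact ⟨x, _, ⟨J, hx, hm j (openInterval_subset_closedInterval _ hj)⟩, hω, hj⟩

theorem isUniversal_universalTest : IsUniversal IsUniformBernoulliTest universalTest := by
  refine ⟨isUniformBernoulliTest_universalTest, fun t ht => ?_⟩
  obtain ⟨S, hS, hSt⟩ := ht.exists_represents
  obtain ⟨C, hC⟩ := exists_le_mul_universalTest hS
  exact ⟨C, fun z => hC z.2 _ (hSt z.2) (ht.2 z.2) z.1⟩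

/-! ### The infimum over the parameter -/

theorem IsBernoulliTest.isUniformBernoulliTest {t : Omega → ℝ≥0∞} (ht : IsBernoulliTest t) :
    IsUniformBernoulliTest fun z => t z.1 := by
  obtain ⟨⟨W, hW, hWt⟩, hint⟩ := ht
  have hinput : Primrec fun q : RatCode × List Bool × RatCode × RatCode => (q.1, q.2.1) := by
    fun_prop
  have hfull : PrimrecPred fun q : RatCode × List Bool × RatCode × RatCode =>
      q.2.2 = ((0, 1, 0), (2, 0, 0)) := Primrec.eq.comp (by fun_prop) (Primrec.const _)
  refine ⟨⟨fun q => W (q.1, q.2.1) ∧ q.2.2 = ((0, 1, 0), (2, 0, 0)), rePredIn_empty.2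
    (rePred_and (rePred_comp (rePredIn_empty.1 hW) hinput.to_comp) hfull.computablePred.to_re),
    fun r => Set.ext fun z => (Set.ext_iff.1 (hWt r) z.1).trans ?_⟩, hint⟩
  constructor
  · rintro ⟨x, hx, hz⟩
    exact ⟨(x, (0, 1, 0), (2, 0, 0)), ⟨hx, rfl⟩, hz, (mem_rectangle_univ z).2⟩
  · rintro ⟨a, ⟨ha, -⟩, hz⟩
    exact ⟨a.1, ha, hz.1⟩

theorem ratOf_lt_iInf_iff {ι : Type*} {f : ι → ℝ≥0∞} {r : RatCode} :
    ((ratOf r : ℝ) : EReal) < ((⨅ i, f i : ℝ≥0∞) : EReal) ↔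
      ∃ r', ratOf r < ratOf r' ∧ ∀ i, ((ratOf r' : ℝ) : EReal) < (f i : EReal) := by
  constructor
  · intro h
    obtain ⟨q, hrq, hq⟩ := EReal.lt_iff_exists_rat_btwn.1 h
    obtain ⟨r', rfl⟩ := exists_ratOf_eq q
    exact ⟨r', by exact_mod_cast hrq,
      fun i => hq.trans_le (EReal.coe_ennreal_le_coe_ennreal_iff.2 (iInf_le f i))⟩
  · rintro ⟨r', hrr', hr'⟩
    have hlt : (ratOf r : ℝ) < ratOf r' := by exact_mod_cast hrr'
    rw [lt_coe_ennreal_iff]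
    refine (lt_or_ge (ratOf r : ℝ) 0).imp_right fun hr => ?_
    refine ((ENNReal.ofReal_lt_ofReal_iff (hr.trans_lt hlt)).2 hlt).trans_le (le_iInf fun i => ?_)
    exact ((lt_coe_ennreal_iff.1 (hr' i)).resolve_left (not_lt.2 (hr.trans hlt.le))).le

theorem inside_cell_of_ball_subset {J : RatCode × RatCode} {m j : ℕ} {δ : ℝ}
    (hδ : ((2 : ℝ) ^ m)⁻¹ < δ) (h : Metric.ball ((j : ℝ) / 2 ^ m) δ ⊆ openInterval J) :
    Inside (cell (m, j)) J := by
  rw [Real.ball_eq_Ioo] at h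
  have hinv : 0 < ((2 : ℝ) ^ m)⁻¹ := by positivity
  have hfst : (ratOf (cell (m, j)).1 : ℝ) ∈ openInterval J := h (by
    rw [coe_ratOf_cell_fst, sub_div, one_div]
    constructor <;> linarith)
  have hsnd : (ratOf (cell (m, j)).2 : ℝ) ∈ openInterval J := h (by
    rw [coe_ratOf_cell_snd, add_div, one_div]
    constructor <;> linarith)
  exact ⟨by exact_mod_cast hfst.1, by exact_mod_cast hsnd.2⟩

theorem exists_forall_cell_inside {A : Set (RatCode × RatCode)}
    (hA : ∀ p : I, ∃ J ∈ A, (p : ℝ) ∈ openInterval J) :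
    ∃ m, ∀ j < 2 ^ m + 1, ∃ J ∈ A, Inside (cell (m, j)) J := by
  obtain ⟨δ, hδ, hball⟩ := lebesgue_number_lemma_of_metric (s := Set.Icc (0 : ℝ) 1)
    (c := fun J : A => openInterval J) isCompact_Icc (fun _ => isOpen_Ioo) fun p hp => by
      obtain ⟨J, hJ, hpJ⟩ := hA ⟨p, hp⟩
      exact Set.mem_iUnion.2 ⟨⟨J, hJ⟩, hpJ⟩
  obtain ⟨m, hm⟩ := exists_pow_lt_of_lt_one hδ (show (2⁻¹ : ℝ) < 1 by norm_num)
  refine ⟨m, fun j hj => ?_⟩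
  have hj' : (j : ℝ) ≤ 2 ^ m := by exact_mod_cast Nat.lt_succ_iff.1 hj
  obtain ⟨J, hJ⟩ := hball ((j : ℝ) / 2 ^ m) ⟨by positivity, div_le_one_of_le₀ hj' (by positivity)⟩
  exact ⟨J, J.2, inside_cell_of_ball_subset (by rwa [← inv_pow]) hJ⟩

theorem exists_lt_mem_openInterval_cell (p : I) (m : ℕ) :
    ∃ j < 2 ^ m + 1, (p : ℝ) ∈ openInterval (cell (m, j)) := by
  obtain ⟨j, hj⟩ := exists_mem_openInterval_cell p.2.1 m
  refine ⟨j, ?_, hj⟩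
  have hlt := hj.1
  rw [coe_ratOf_cell_fst, div_lt_iff₀ (by positivity)] at hlt
  have hle : (p : ℝ) * 2 ^ m ≤ 2 ^ m := mul_le_of_le_one_left (by positivity) p.2.2
  exact_mod_cast (show (j : ℝ) < 2 ^ m + 1 by linarith)

/-- Compactness of `[0,1]` turns the quantifier over `p` into a bounded one over the cells of some
mesh, which is why the infimum over `p` of an enumerable function is enumerable. -/
theorem forall_exists_mem_rectangle_iff {A : Set (List Bool × RatCode × RatCode)} {ω : Omega} :
    (∀ p : I, ∃ a ∈ A, (ω, p) ∈ rectangle a) ↔ ∃ x, (∃ m, ∀ j < 2 ^ m + 1,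
      ∃ a, (a ∈ A ∧ a.1 <+: x) ∧ Inside (cell (m, j)) a.2) ∧ ω ∈ wordCylinder x := by
  constructor
  · intro h
    obtain ⟨m, hm⟩ := exists_forall_cell_inside
      (A := {J | ∃ x, (x, J) ∈ A ∧ ω ∈ wordCylinder x}) fun p => by
        obtain ⟨⟨x, J⟩, ha, hω, hp⟩ := h p
        exact ⟨J, ⟨x, ha, hω⟩, hp⟩
    have hm' : ∀ j < 2 ^ m + 1, ∃ a, (a ∈ A ∧ ω ∈ wordCylinder a.1) ∧ Inside (cell (m, j)) a.2 := by
      intro j hj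
      obtain ⟨J, ⟨x, hx⟩, hJ⟩ := hm j hj
      exact ⟨(x, J), hx, hJ⟩
    choose! a ha hinside using hm'
    let s := (Finset.range (2 ^ m + 1)).sup fun j => (a j).1.length
    have hs : ∀ j < 2 ^ m + 1, (a j).1.length ≤ s := fun j hj =>
      Finset.le_sup (f := fun j => (a j).1.length) (Finset.mem_range.2 hj)
    exact ⟨digitPrefix ω s, ⟨m, fun j hj => ⟨a j, ⟨(ha j hj).1,
      isPrefix_digitPrefix_iff.2 ⟨hs j hj, (ha j hj).2⟩⟩, hinside j hj⟩⟩,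
      (isPrefix_digitPrefix_iff.1 List.prefix_rfl).2⟩
  · rintro ⟨x, ⟨m, hm⟩, hω⟩ p
    obtain ⟨j, hj, hp⟩ := exists_lt_mem_openInterval_cell p m
    obtain ⟨a, ⟨ha, hax⟩, hinside⟩ := hm j hj
    rw [← mem_wordCylinder_iff.1 hω] at hax
    exact ⟨a, ha, (isPrefix_digitPrefix_iff.1 hax).2,
      hinside.closedInterval_subset (openInterval_subset_closedInterval _ hp)⟩

theorem rePred_exists_cover {W : RatCode × List Bool × RatCode × RatCode → Prop}
    (hW : REPred W) : REPred fun q : RatCode × List Bool => ∃ r, ratOf q.1 < ratOf r ∧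
      ∃ m, ∀ j < 2 ^ m + 1, ∃ a, (W (r, a) ∧ a.1 <+: q.2) ∧ Inside (cell (m, j)) a.2 := by
  have hlt : PrimrecPred fun q : (RatCode × List Bool) × RatCode => ratOf q.1.1 < ratOf q.2 :=
    primrecRel_ratOf_lt.comp (by fun_prop) (by fun_prop)
  have hmem : REPred fun q : ((((RatCode × List Bool) × RatCode) × ℕ) × ℕ) ×
      List Bool × RatCode × RatCode => W (q.1.1.1.2, q.2) :=
    rePred_comp hW (Primrec.to_comp (by fun_prop))
  have hprefix : PrimrecPred fun q : ((((RatCode × List Bool) × RatCode) × ℕ) × ℕ) ×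
      List Bool × RatCode × RatCode => q.2.1 <+: q.1.1.1.1.2 :=
    primrecRel_isPrefix.comp (by fun_prop) (by fun_prop)
  have hcell : Primrec fun q : (((RatCode × List Bool) × RatCode) × ℕ) × ℕ =>
      cell (q.1.2, q.2) := by fun_prop
  have hpiece := rePred_exists_inside (W := fun q a => W (q.1.1.2, a) ∧ a.1 <+: q.1.1.1.2)
    (rePred_and hmem hprefix.computablePred.to_re) hcell Primrec.snd
  have hcells := rePred_forall_lt (P := fun (q : ((RatCode × List Bool) × RatCode) × ℕ) j =>
    ∃ a, (W (q.1.2, a) ∧ a.1 <+: q.1.1.2) ∧ Inside (cell (q.2, j)) a.2) hpiece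
    (f := fun q => 2 ^ q.2 + 1) (by fun_prop)
  exact rePred_exists (rePred_and hlt.computablePred.to_re (rePred_exists hcells))

theorem IsUniformBernoulliTest.isBernoulliTest_iInf {t : Omega × I → ℝ≥0∞}
    (ht : IsUniformBernoulliTest t) : IsBernoulliTest fun ω => ⨅ p : I, t (ω, p) := by
  obtain ⟨⟨W, hW, hWt⟩, hint⟩ := ht
  refine ⟨⟨_, rePredIn_empty.2 (rePred_exists_cover (rePredIn_empty.1 hW)),
    fun r => Set.ext fun ω => ratOf_lt_iInf_iff.trans ?_⟩,
    fun p => (lintegral_mono fun ω => iInf_le _ p).trans (hint p)⟩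
  have hcover (r' : RatCode) : (∀ p, ((ratOf r' : ℝ) : EReal) < (t (ω, p) : EReal)) ↔ _ :=
    (forall_congr' fun p => Set.ext_iff.1 (hWt r') (ω, p)).trans
      (forall_exists_mem_rectangle_iff (A := {a | W (r', a)}))
  simp only [hcover, Set.mem_ofPred_eq]
  constructor
  · rintro ⟨r', hr, x, hx, hω⟩
    exact ⟨x, ⟨r', hr, hx⟩, hω⟩
  · rintro ⟨x, ⟨r', hr, hx⟩, hω⟩
    exact ⟨r', hr, x, hx, hω⟩

theorem IsUniversal.iInf {t : Omega × I → ℝ≥0∞} (ht : IsUniversal IsUniformBernoulliTest t) :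
    IsUniversal IsBernoulliTest fun ω => ⨅ p : I, t (ω, p) := by
  refine ⟨ht.1.isBernoulliTest_iInf, fun s hs => ?_⟩
  obtain ⟨c, hc⟩ := ht.2 _ hs.isUniformBernoulliTest
  refine ⟨c, fun ω => ?_⟩
  rw [ENNReal.mul_iInf (by simp)]
  exact le_iInf fun p => hc (ω, p)

/-! ### Binary expansions of the parameter -/

theorem ofDigits_pos {B : ℕ} {b : ℕ → Fin B} {n : ℕ} (h : 0 < (b n : ℕ)) :
    0 < Real.ofDigits b := by
  refine Real.summable_ofDigitsTerm.tsum_pos (fun _ => Real.ofDigitsTerm_nonneg) n ?_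
  have hB : (0 : ℝ) < B := by exact_mod_cast h.trans (b n).2
  rw [Real.ofDigitsTerm]
  positivity

theorem ofDigits_lt_one {B : ℕ} {b : ℕ → Fin B} {n : ℕ} (h : (b n : ℕ) + 1 < B) :
    Real.ofDigits b < 1 := by
  have : NeZero B := ⟨by omega⟩
  have hB : (0 : ℝ) < B := by exact_mod_cast (by omega : 0 < B)
  rw [← Real.ofDigits_const_last_eq_one' (by omega : 1 < B)]
  refine Summable.tsum_lt_tsum (i := n) (fun i => ?_) ?_ Real.summable_ofDigitsTerm
    Real.summable_ofDigitsTerm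
  · simp only [Real.ofDigitsTerm]
    gcongr
    exact Nat.le_sub_one_of_lt (b i).2
  · simp only [Real.ofDigitsTerm]
    gcongr
    exact Nat.lt_sub_of_add_lt h

/-- The natural number with the binary digits `τ`, the most significant first. -/
def binVal (τ : List (Fin 2)) : ℕ := Nat.ofDigits 2 (τ.map Fin.val).reverse

theorem binVal_concat (τ : List (Fin 2)) (d : Fin 2) :
    binVal (τ ++ [d]) = d + 2 * binVal τ := by
  simp [binVal, Nat.ofDigits_cons]

theorem binVal_injective {τ τ' : List (Fin 2)} (hlen : τ.length = τ'.length)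
    (h : binVal τ = binVal τ') : τ = τ' := by
  have hlt (τ : List (Fin 2)) : ∀ d ∈ (τ.map Fin.val).reverse, d < 2 := fun d hd => by
    obtain ⟨d', -, rfl⟩ := List.mem_map.1 (List.mem_reverse.1 hd)
    exact d'.2
  have hval := Nat.ofDigits_inj_of_len_eq one_lt_two (by simpa using hlen) (hlt τ) (hlt τ') h
  exact List.map_injective_iff.2 Fin.val_injective (List.reverse_injective hval)

theorem primrec_binVal : Primrec binVal := by
  have hdigits : Primrec fun τ : List (Fin 2) => (τ.map Fin.val).reverse :=
    Primrec.list_reverse.comp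
      (Primrec.list_map Primrec.id (Primrec.fin_val.comp Primrec.snd).to₂)
  have hstep : Primrec fun q : List (Fin 2) × ℕ × ℕ => q.2.1 + 2 * q.2.2 := by fun_prop
  refine (Primrec.list_foldr hdigits (Primrec.const 0) hstep.to₂).of_eq fun τ => ?_
  simp [binVal, Nat.ofDigits_eq_foldr]

attribute [local fun_prop] primrec_binVal

/-- The interval of the numbers that have a binary expansion beginning with `τ`. -/
def digitInterval (τ : List (Fin 2)) : RatCode × RatCode :=
  (dyadicCode (binVal τ) τ.length, dyadicCode (binVal τ + 1) τ.length)

theorem primrec_digitInterval : Primrec digitInterval := by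
  have hlength : Primrec fun τ : List (Fin 2) => τ.length := Primrec.list_length
  exact Primrec.pair (primrec_dyadicCode primrec_binVal hlength)
    (primrec_dyadicCode (by fun_prop) hlength)

theorem coe_ratOf_digitInterval_fst (b : ℕ → Fin 2) (n : ℕ) :
    (ratOf (digitInterval (digitPrefix b n)).1 : ℝ) =
      ∑ i ∈ Finset.range n, Real.ofDigitsTerm b i := by
  rw [digitInterval, coe_ratOf_dyadicCode, length_digitPrefix]
  induction n with
  | zero => simp [digitPrefix, binVal]
  | succ n ih =>
    rw [Finset.sum_range_succ, ← ih, digitPrefix_succ, binVal_concat, Real.ofDigitsTerm]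
    push_cast
    field_simp
    ring

theorem coe_ratOf_digitInterval_snd (b : ℕ → Fin 2) (n : ℕ) :
    (ratOf (digitInterval (digitPrefix b n)).2 : ℝ) =
      ratOf (digitInterval (digitPrefix b n)).1 + ((2 : ℝ) ^ n)⁻¹ := by
  simp only [digitInterval, coe_ratOf_dyadicCode, length_digitPrefix]
  push_cast
  rw [add_div, one_div]

section Expansion

variable {p : I} {b : ℕ → Fin 2}

theorem IsBinaryExpansion.eq_add_mul (hb : IsBinaryExpansion p b) (n : ℕ) :
    (p : ℝ) = ratOf (digitInterval (digitPrefix b n)).1 +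
      ((2 : ℝ) ^ n)⁻¹ * Real.ofDigits fun i => b (i + n) := by
  rw [coe_ratOf_digitInterval_fst, ← show Real.ofDigits b = p from hb]
  exact_mod_cast Real.ofDigits_eq_sum_add_ofDigits b n

theorem IsBinaryExpansion.mem_closedInterval (hb : IsBinaryExpansion p b) (n : ℕ) :
    (p : ℝ) ∈ closedInterval (digitInterval (digitPrefix b n)) := by
  rw [closedInterval, coe_ratOf_digitInterval_snd, hb.eq_add_mul n]
  have hnonneg := Real.ofDigits_nonneg fun i => b (i + n)
  refine ⟨le_add_of_nonneg_right (by positivity), ?_⟩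
  gcongr
  exact mul_le_of_le_one_right (by positivity) (Real.ofDigits_le_one _)

theorem IsBinaryExpansion.mem_openInterval (hb : IsBinaryExpansion p b)
    (hne : ∀ N d, ∃ n ≥ N, b n ≠ d) (n : ℕ) :
    (p : ℝ) ∈ openInterval (digitInterval (digitPrefix b n)) := by
  have htail (d : Fin 2) : ∃ i, b (i + n) ≠ d := by
    obtain ⟨k, hk, hbk⟩ := hne n d
    exact ⟨k - n, by rwa [Nat.sub_add_cancel hk]⟩
  obtain ⟨i, hi⟩ := htail 0
  obtain ⟨j, hj⟩ := htail 1
  have hpos : 0 < Real.ofDigits fun i => b (i + n) := ofDigits_pos (n := i) (by grind)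
  have hlt : (Real.ofDigits fun i => b (i + n)) < 1 := ofDigits_lt_one (n := j) (by grind)
  rw [openInterval, coe_ratOf_digitInterval_snd, hb.eq_add_mul n]
  refine ⟨lt_add_of_pos_right _ (by positivity), ?_⟩
  gcongr
  exact mul_lt_of_lt_one_right (by positivity) hlt

theorem eq_of_mem_digitInterval {τ τ' : List (Fin 2)} (hlen : τ.length = τ'.length) {p : ℝ}
    (hτ : p ∈ openInterval (digitInterval τ)) (hτ' : p ∈ closedInterval (digitInterval τ')) :
    τ = τ' := by
  refine binVal_injective hlen ?_
  obtain ⟨hτ_lower, hτ_upper⟩ := hτ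
  obtain ⟨hτ'_lower, hτ'_upper⟩ := hτ'
  simp only [digitInterval, coe_ratOf_dyadicCode, ← hlen] at *
  have hlt := hτ_lower.trans_le hτ'_upper
  have hgt := hτ'_lower.trans_lt hτ_upper
  rw [div_lt_div_iff_of_pos_right (by positivity), Nat.cast_lt] at hlt hgt
  omega

theorem IsBinaryExpansion.exists_inside (hb : IsBinaryExpansion p b) {J : RatCode × RatCode}
    (hp : (p : ℝ) ∈ openInterval J) : ∃ n, Inside (digitInterval (digitPrefix b n)) J := by
  obtain ⟨n, hlower, hupper⟩ :=
    ((tendsto_two_mul_inv_two_pow.eventually (gt_mem_nhds (sub_pos.2 hp.1))).and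
      (tendsto_two_mul_inv_two_pow.eventually (gt_mem_nhds (sub_pos.2 hp.2)))).exists
  obtain ⟨hle, hge⟩ := hb.mem_closedInterval n
  have hwidth := coe_ratOf_digitInterval_snd b n
  have hinv : 0 < ((2 : ℝ) ^ n)⁻¹ := by positivity
  refine ⟨n, ?_, ?_⟩ <;> rw [← Rat.cast_lt (K := ℝ)] <;> linarith

theorem primrec_of_eventually_const {α : Type*} [Primcodable α] {b : ℕ → α} {N : ℕ} {d : α}
    (hb : ∀ n ≥ N, b n = d) : Primrec b := by
  refine (Primrec.option_getD.comp (Primrec.list_getElem?₁ (digitPrefix b N))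
    (Primrec.const d)).of_eq fun n => ?_
  rcases lt_or_ge n N with hn | hn
  · rw [getElem?_digitPrefix b hn, Option.getD_some]
  · rw [List.getElem?_eq_none (by rwa [length_digitPrefix]), Option.getD_none, hb n hn]

theorem REPredIn.rePred {α : Type} [Primcodable α] {P : α → Prop}
    (hP : REPredIn (digitOracle b) P) (hb : Computable b) : REPred P := by
  refine RecursiveIn.partrec_of_oracle ?_ hP
  rintro _ rfl
  exact (Primrec.fin_val.to_comp.comp hb).partrec

/-- An eventually constant expansion is computable. Otherwise `p` is an interior point of the
interval of each digit prefix, so a finite part of the oracle can be read off from a neighborhood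
of `p`. -/
theorem REPredIn.exists_local {α : Type} [Primcodable α] {P : α → Prop}
    (hP : REPredIn (digitOracle b) P) (hb : IsBinaryExpansion p b) :
    ∃ S : α × RatCode × RatCode → Prop, REPred S ∧
      (∀ a J, S (a, J) → (p : ℝ) ∈ closedInterval J → P a) ∧
      ∀ a, P a → ∃ J, (p : ℝ) ∈ openInterval J ∧ S (a, J) := by
  by_cases hne : ∀ N d, ∃ n ≥ N, b n ≠ d
  · obtain ⟨V, hV, hPV⟩ := rePredIn_digitOracle_iff.1 hP
    have hinput : Primrec fun q : (α × RatCode × RatCode) × List (Fin 2) => (q.2, q.1.1) := by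
      fun_prop
    have hS := rePred_exists_inside (W := fun q τ => V (τ, q.1))
      (rePred_comp hV hinput.to_comp) Primrec.snd primrec_digitInterval
    refine ⟨_, hS, ?_, fun a ha => ?_⟩
    · rintro a J ⟨τ, hτ, hJ⟩ hp
      have hprefix := eq_of_mem_digitInterval (length_digitPrefix b τ.length).symm
        (hJ.closedInterval_subset hp) (hb.mem_closedInterval τ.length)
      exact (hPV a).2 ⟨_, hprefix ▸ hτ⟩
    · obtain ⟨n, hn⟩ := (hPV a).1 ha
      obtain ⟨m, hm⟩ := (eventually_inside_cell (hb.mem_openInterval hne n)).exists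
      obtain ⟨j, hj⟩ := exists_mem_openInterval_cell p.2.1 m
      exact ⟨_, hj, _, hn, hm j (openInterval_subset_closedInterval _ hj)⟩
  · push Not at hne
    obtain ⟨N, d, hd⟩ := hne
    have hP' := hP.rePred (primrec_of_eventually_const hd).to_comp
    obtain ⟨j, hj⟩ := exists_mem_openInterval_cell p.2.1 0
    exact ⟨fun q => P q.1, rePred_comp hP' Computable.fst, fun _ _ h _ => h,
      fun a ha => ⟨_, hj, ha⟩⟩

theorem IsTest.exists_represents {s : Omega → ℝ≥0∞}
    (hs : IsTest (digitOracle b) (bernoulliProd p) s) (hb : IsBinaryExpansion p b) :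
    ∃ S, REPred S ∧ Represents S p s := by
  obtain ⟨W, hW, hWs⟩ := hs.1.exists_natCast_lt_iff
  obtain ⟨S, hS, hSW, hWS⟩ := hW.exists_local hb
  have hpiece : Primrec fun e : Piece => ((e.1, e.2.1), e.2.2) := by fun_prop
  refine ⟨fun e => S ((e.1, e.2.1), e.2.2), rePred_comp hS hpiece.to_comp,
    fun {e ω} he hp hω => ?_, fun {r ω} hr => ?_⟩
  · exact ((hWs e.1 ω).2 ⟨_, hSW _ _ he hp, hω⟩).le
  · obtain ⟨x, hx, hω⟩ := (hWs r ω).1 hr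
    obtain ⟨J, hJ, hxJ⟩ := hWS _ hx
    exact ⟨x, J, hxJ, hω, hJ⟩

theorem IsTest.dominatedBy {s : Omega → ℝ≥0∞}
    (hs : IsTest (digitOracle b) (bernoulliProd p) s) (hb : IsBinaryExpansion p b) :
    DominatedBy s fun ω => universalTest (ω, p) := by
  obtain ⟨S, hS, hSs⟩ := hs.exists_represents hb
  obtain ⟨C, hC⟩ := exists_le_mul_universalTest hS
  exact ⟨C, hC p s hSs hs.2⟩

theorem IsUniformBernoulliTest.isTest {t : Omega × I → ℝ≥0∞} (ht : IsUniformBernoulliTest t)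
    (hb : IsBinaryExpansion p b) :
    IsTest (digitOracle b) (bernoulliProd p) fun ω => t (ω, p) := by
  obtain ⟨⟨W, hW, hWt⟩, hint⟩ := ht
  have hinput : Primrec fun q : (List (Fin 2) × RatCode × List Bool) × RatCode × RatCode =>
    (q.1.2.1, q.1.2.2, q.2) := by fun_prop
  have hslice := rePred_exists_inside
    (W := fun (q : List (Fin 2) × RatCode × List Bool) J => W (q.2.1, q.2.2, J))
    (rePred_comp (rePredIn_empty.1 hW) hinput.to_comp)
    (primrec_digitInterval.comp Primrec.fst) Primrec.id
  refine ⟨⟨_, rePredIn_digitOracle_iff.2 ⟨_, hslice, fun _ => Iff.rfl⟩, fun r => Set.ext fun ω =>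
    (Set.ext_iff.1 (hWt r) (ω, p)).trans ⟨?_, ?_⟩⟩, hint p⟩
  · rintro ⟨⟨x, J⟩, hx, hω, hp⟩
    obtain ⟨n, hn⟩ := hb.exists_inside hp
    exact ⟨x, ⟨n, J, hx, hn⟩, hω⟩
  · rintro ⟨x, ⟨n, J, hx, hn⟩, hω⟩
    exact ⟨(x, J), hx, hω, hn.closedInterval_subset (hb.mem_closedInterval n)⟩

theorem IsUniversal.slice {t : Omega × I → ℝ≥0∞} (ht : IsUniversal IsUniformBernoulliTest t)
    (hb : IsBinaryExpansion p b) :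
    IsUniversal (IsTest (digitOracle b) (bernoulliProd p)) fun ω => t (ω, p) :=
  ⟨ht.1.isTest hb, fun _ hs => (hs.dominatedBy hb).trans
    ((ht.2 _ isUniformBernoulliTest_universalTest).comp fun ω => (ω, p))⟩

end Expansion

/-! ### Martin-Löf tests and tests of bounded expectation -/

theorem UniformlyEffectivelyOpen.measurableSet {ι : Type} [Primcodable ι] {O : Set (ℕ →. ℕ)}
    {U : ι → Set Omega} (hU : UniformlyEffectivelyOpen O wordCylinder U) (i : ι) :
    MeasurableSet (U i) := by
  obtain ⟨W, -, hWU⟩ := hU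
  have hunion : U i = ⋃ x ∈ {x | W (i, x)}, wordCylinder x := by
    ext ω
    simp [hWU]
  rw [hunion]
  exact MeasurableSet.biUnion (Set.to_countable _) fun x _ => measurableSet_wordCylinder x

theorem IsTest.isMartinLofTest {O : Set (ℕ →. ℕ)} {P : Measure Omega} {t : Omega → ℝ≥0∞}
    (ht : IsTest O P t) : IsMartinLofTest O P fun i => {ω | (2 : ℝ≥0∞) ^ i < t ω} := by
  obtain ⟨W, hW, hWt⟩ := ht.1.exists_natCast_lt_iff
  have hinput : Primrec fun q : ℕ × List Bool => (2 ^ q.1, q.2) := by fun_prop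
  have hopen : UniformlyEffectivelyOpen O wordCylinder fun i : ℕ => {ω | (2 : ℝ≥0∞) ^ i < t ω} :=
    ⟨_, hW.comp hinput.to_comp, fun i => Set.ext fun ω => by exact_mod_cast hWt (2 ^ i) ω⟩
  refine ⟨hopen, fun i => ?_⟩
  have hmarkov : 2 ^ i * P {ω | (2 : ℝ≥0∞) ^ i < t ω} ≤ 1 := by
    rw [← lintegral_indicator_const (hopen.measurableSet i)]
    exact (lintegral_mono (Set.indicator_le fun _ h => le_of_lt h)).trans ht.2
  rwa [← ENNReal.inv_pow, ← one_div, ENNReal.le_div_iff_mul_le (.inl (by simp)) (.inl (by simp)),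
    mul_comm]

/-- The steps whose supremum is the test of bounded expectation obtained from a Martin-Löf test
that `W` enumerates: the value `2 ^ i` on the set with the index `2 * i + 1`, of measure at most
`2⁻¹ ^ (2 * i + 1)`, and the value `0` everywhere. -/
def martinLofStep (W : ℕ × List Bool → Prop) (w : (ℕ × ℕ) × List Bool) : Prop :=
  (∃ i, W (2 * i + 1, w.2) ∧ w.1 = (2 ^ i, 0)) ∨ w = ((0, 0), [])

theorem lowerSemicomputable_stepSup_martinLofStep {g : ℕ → ℕ} {W : ℕ × List Bool → Prop}
    (hW : REPredIn (totalOracle g) W) :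
    LowerSemicomputable (totalOracle g) wordCylinder
      (stepSup wordCylinder (martinLofStep W)) := by
  refine lowerSemicomputable_stepSup ?_ fun ω => ⟨_, .inr rfl, fun i => i.elim0⟩
  have hinput : Primrec fun q : ((ℕ × ℕ) × List Bool) × ℕ => (2 * q.2 + 1, q.1.2) := by fun_prop
  have hvalue : PrimrecPred fun q : ((ℕ × ℕ) × List Bool) × ℕ => q.1.1 = (2 ^ q.2, 0) :=
    Primrec.eq.comp (by fun_prop) (by fun_prop)
  have hzero : PrimrecPred fun w : (ℕ × ℕ) × List Bool => w = ((0, 0), []) :=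
    Primrec.eq.comp Primrec.id (Primrec.const _)
  have hstep : REPredIn (totalOracle g) (martinLofStep W) :=
    (REPredIn.exists (P := fun (w : (ℕ × ℕ) × List Bool) i =>
      W (2 * i + 1, w.2) ∧ w.1 = (2 ^ i, 0))
      ((hW.comp hinput.to_comp).and_rePred hvalue.computablePred.to_re)).or_rePred
      hzero.computablePred.to_re
  have hswap : Primrec fun q : (RatCode × List Bool) × ℕ × ℕ => (q.2, q.1.2) := by fun_prop
  have hlt : PrimrecPred fun q : (RatCode × List Bool) × ℕ × ℕ =>
      ratOf q.1.1 < ratOf (dyadicCode q.2.1 q.2.2) :=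
    primrecRel_ratOf_lt.comp (by fun_prop) (by fun_prop)
  exact REPredIn.exists (P := fun (q : RatCode × List Bool) d =>
    martinLofStep W (d, q.2) ∧ ratOf q.1 < ratOf (dyadicCode d.1 d.2))
    ((hstep.comp hswap.to_comp).and_rePred hlt.computablePred.to_re)

theorem stepSup_martinLofStep_le_tsum {W : ℕ × List Bool → Prop} {U : ℕ → Set Omega}
    (hWU : ∀ i, U i = {ω | ∃ x, W (i, x) ∧ ω ∈ wordCylinder x}) (ω : Omega) :
    stepSup wordCylinder (martinLofStep W) ω ≤
      ∑' i, (U (2 * i + 1)).indicator (fun _ => (2 : ℝ≥0∞) ^ i) ω := by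
  refine stepSup_le fun a m x hstep hω => ?_
  rcases hstep with ⟨i, hx, heq⟩ | heq
  · obtain ⟨rfl, rfl⟩ := Prod.mk.inj heq
    have hmem : ω ∈ U (2 * i + 1) := hWU _ ▸ ⟨x, hx, hω⟩
    refine le_trans ?_ (ENNReal.le_tsum i)
    rw [Set.indicator_of_mem hmem]
    simp
  · obtain ⟨⟨rfl, rfl⟩, rfl⟩ := Prod.mk.inj heq
    simp

theorem stepSup_martinLofStep_eq_top {W : ℕ × List Bool → Prop} {U : ℕ → Set Omega}
    (hWU : ∀ i, U i = {ω | ∃ x, W (i, x) ∧ ω ∈ wordCylinder x}) {ω : Omega}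
    (hω : ω ∈ ⋂ i, U i) : stepSup wordCylinder (martinLofStep W) ω = ∞ := by
  refine ENNReal.eq_top_of_forall_nnreal_le fun r => ?_
  obtain ⟨i, hi⟩ := pow_unbounded_of_one_lt r one_lt_two
  obtain ⟨x, hx, hωx⟩ : ∃ x, W (2 * i + 1, x) ∧ ω ∈ wordCylinder x :=
    (Set.ext_iff.1 (hWU (2 * i + 1)) ω).1 (Set.mem_iInter.1 hω _)
  calc (r : ℝ≥0∞) ≤ ((2 ^ i : ℕ) : ℝ≥0∞) * 2⁻¹ ^ 0 := by
        rw [pow_zero, mul_one]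
        exact_mod_cast hi.le
    _ ≤ _ := le_stepSup (.inl ⟨i, hx, rfl⟩) hωx

theorem tsum_two_pow_mul_le_one {μ : ℕ → ℝ≥0∞} (hμ : ∀ i, μ i ≤ 2⁻¹ ^ i) :
    ∑' i : ℕ, 2 ^ i * μ (2 * i + 1) ≤ 1 := by
  have hcancel : (2 : ℝ≥0∞) * 2⁻¹ = 1 := ENNReal.mul_inv_cancel two_ne_zero ENNReal.ofNat_ne_top
  calc ∑' i : ℕ, 2 ^ i * μ (2 * i + 1) ≤ ∑' i : ℕ, (2⁻¹ : ℝ≥0∞) ^ (i + 1) := by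
        refine ENNReal.tsum_le_tsum fun i => ?_
        calc 2 ^ i * μ (2 * i + 1) ≤ 2 ^ i * 2⁻¹ ^ (2 * i + 1) := by gcongr; exact hμ _
          _ = (2 * 2⁻¹) ^ i * 2⁻¹ ^ (i + 1) := by ring
          _ = 2⁻¹ ^ (i + 1) := by rw [hcancel, one_pow, one_mul]
    _ = 1 := by
        rw [ENNReal.tsum_geometric_add_one, ENNReal.one_sub_inv_two, inv_inv, mul_comm, hcancel]

theorem IsMartinLofTest.exists_isTest {g : ℕ → ℕ} {P : Measure Omega} {U : ℕ → Set Omega}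
    (hU : IsMartinLofTest (totalOracle g) P U) :
    ∃ t, IsTest (totalOracle g) P t ∧ ∀ ω ∈ ⋂ i, U i, t ω = ∞ := by
  obtain ⟨hopen, hP⟩ := hU
  have hmeas := hopen.measurableSet
  obtain ⟨W, hW, hWU⟩ := hopen
  refine ⟨_, ⟨lowerSemicomputable_stepSup_martinLofStep hW, ?_⟩,
    fun ω hω => stepSup_martinLofStep_eq_top hWU hω⟩
  calc ∫⁻ ω, stepSup wordCylinder (martinLofStep W) ω ∂P
      ≤ ∫⁻ ω, ∑' i, (U (2 * i + 1)).indicator (fun _ => (2 : ℝ≥0∞) ^ i) ω ∂P :=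
        lintegral_mono (stepSup_martinLofStep_le_tsum hWU)
    _ = ∑' i : ℕ, 2 ^ i * P (U (2 * i + 1)) := by
        rw [lintegral_tsum fun i => (measurable_const.indicator (hmeas _)).aemeasurable]
        simp only [lintegral_indicator_const (hmeas _)]
    _ ≤ 1 := tsum_two_pow_mul_le_one hP

theorem isMartinLofRandom_iff_isRandom {g : ℕ → ℕ} {P : Measure Omega} {ω : Omega} :
    IsMartinLofRandom (totalOracle g) P ω ↔ IsRandom (totalOracle g) P ω := by
  constructor
  · intro h t ht
    by_contra htop
    rw [not_lt, top_le_iff] at htop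
    refine h _ ht.isMartinLofTest (Set.mem_iInter.2 fun i => ?_)
    rw [Set.mem_ofPred_eq, htop]
    exact ENNReal.pow_lt_top ENNReal.ofNat_lt_top
  · intro h U hU hω
    obtain ⟨t, ht, htop⟩ := hU.exists_isTest
    exact (h t ht).ne (htop ω hω)

theorem lt_top_iff_exists_isRandom {bin : I → ℕ → Fin 2} (hbin : ∀ p, IsBinaryExpansion p (bin p))
    {tB : Omega → ℝ≥0∞} (htB : IsUniversal IsBernoulliTest tB) (ω : Omega) :
    tB ω < ∞ ↔ ∃ p : I, IsRandom (digitOracle (bin p)) (bernoulliProd p) ω := by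
  have heq := isUniversal_universalTest.iInf.eqUpToConst htB
  constructor
  · intro h
    obtain ⟨p, hp⟩ := iInf_lt_iff.1 (heq.1.lt_top h)
    exact ⟨p, fun s hs => (hs.dominatedBy (hbin p)).lt_top hp⟩
  · rintro ⟨p, hp⟩
    exact heq.2.lt_top (iInf_lt_iff.2
      ⟨p, hp _ (isUniformBernoulliTest_universalTest.isTest (hbin p))⟩)

end BernoulliTests

theorem mainTheorem3 :
    -- universal tests of the three kinds exist
    (∃ tB, IsUniversal IsBernoulliTest tB) ∧
    (∃ t, IsUniversal IsUniformBernoulliTest t) ∧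
    (∀ (p : I) (b : ℕ → Fin 2), IsBinaryExpansion p b →
      ∃ s, IsUniversal (IsTest (digitOracle b) (bernoulliProd p)) s) ∧
    -- the universal Bernoulli test is the infimum over `p` of the universal uniform one
    (∀ t tB, IsUniversal IsUniformBernoulliTest t → IsUniversal IsBernoulliTest tB →
      EqUpToConst (fun ω => ⨅ p : I, t (ω, p)) tB) ∧
    -- for fixed `p`, the universal uniform test is the universal `B_p`-test with oracle `p`
    (∀ t, IsUniversal IsUniformBernoulliTest t →
      ∀ (p : I) (b : ℕ → Fin 2), IsBinaryExpansion p b →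
        ∀ s, IsUniversal (IsTest (digitOracle b) (bernoulliProd p)) s →
          EqUpToConst (fun ω => t (ω, p)) s) ∧
    -- Bernoulli sequences are those random for some `B_p` with oracle `p`, in the sense of
    -- Martin-Löf tests and of tests of bounded expectation, whatever expansions serve as oracles
    (∀ bin : I → ℕ → Fin 2, (∀ p, IsBinaryExpansion p (bin p)) →
      ∀ tB, IsUniversal IsBernoulliTest tB → ∀ ω : Omega,
        (tB ω < ∞ ↔ ∃ p : I, IsMartinLofRandom (digitOracle (bin p)) (bernoulliProd p) ω) ∧
        (tB ω < ∞ ↔ ∃ p : I, IsRandom (digitOracle (bin p)) (bernoulliProd p) ω)) := by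
  refine ⟨⟨_, isUniversal_universalTest.iInf⟩, ⟨_, isUniversal_universalTest⟩,
    fun p b hb => ⟨_, isUniversal_universalTest.slice hb⟩,
    fun t tB ht htB => ht.iInf.eqUpToConst htB,
    fun t ht p b hb s hs => (ht.slice hb).eqUpToConst hs,
    fun bin hbin tB htB ω => ⟨?_, lt_top_iff_exists_isRandom hbin htB ω⟩⟩
  rw [lt_top_iff_exists_isRandom hbin htB]
  exact exists_congr fun p => isMartinLofRandom_iff_isRandom.symm
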